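/- Let $p$ be a prime, $q=p^n$ with $n\ge 1$, and let $\Bbbk$ be an algebraically closed field of characteristic $p$. For $d\ge 1$ let $\gamma_d:\mathbb{P}^2\to\mathbb{P}^2$ be the morphism $[x_0:x_1:x_2]\mapsto[x_0^d:x_1^d:x_2^d]$ over $\Bbbk$. Let the Ballico–Hefez curve $B\subset\mathbb{P}^2$ be the image of the line $x_0+x_1+x_2=0$ under $\gamma_{q+1}$. Let $C_0\subset\mathbb{P}^2$ be the Fermat curve $x_0^{q^2+q+1}+x_1^{q^2+q+1}+x_2^{q^2+q+1}=0$, and let $C_0^\vee$ be its dual curve, i.e. the Zariski closure of the image of the Gauss map $P\mapsto[\partial F/\partial x_0(P):\partial F/\partial x_1(P):\partial F/\partial x_2(P)]$, where $F$ is the defining polynomial of $C_0$. Then: (i) $C_0^\vee=\gamma_{q^2+q+1}^{-1}(B)$. This holds as an equality of sets and of schemes: if $h(x_0,x_1,x_2)$ is a reduced defining polynomial of $B$, then $h(x_0^{q^2+q+1},x_1^{q^2+q+1},x_2^{q^2+q+1})$ is a reduced defining polynomial of $C_0^\vee$. (ii) The singular points of $C_0^\vee$ are exactly $(q^2+q+1)^2(q^2-q)/2$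 ordinary nodes and $3(q^2+q+1)$ further points, each of Milnor number $q^2(q+1)$. Here the Milnor number of a local equation $f\in\Bbbk[[x,y]]$ is $\dim_{\Bbbk}\Bbbk[[x,y]]/(\partial f/\partial x,\partial f/\partial y)$. At each of these points every local equation (in the coordinates of a standard affine chart, up to units of $\Bbbk[[x,y]]$) has this Milnor number. -/

import Mathlib

open scoped LinearAlgebra.Projectivization

noncomputable section

namespace PlaneCurve

variable {k : Type*} [Field k]

/-- The projective plane over `k`, with homogeneous coordinates indexed by `Fin 3`.
The dual plane is identified with it through the dual coordinates. -/
abbrev Plane (k : Type*) [Field k] : Type _ := ℙ k (Fin 3 → k)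

/-- The ideal of a set of points of the plane: the polynomials that vanish on the (punctured)
affine cone over the set. -/
def idealOf (Z : Set (Plane k)) : Ideal (MvPolynomial (Fin 3) k) :=
  MvPolynomial.vanishingIdeal k {v : Fin 3 → k | ∃ hv : v ≠ 0, Projectivization.mk k v hv ∈ Z}

/-- The set of points of the plane at which a homogeneous polynomial `F` vanishes. -/
def locus (F : MvPolynomial (Fin 3) k) : Set (Plane k) :=
  {P | MvPolynomial.eval P.rep F = 0}

/-- The Zariski closure of a set of points of the plane. -/
def zariskiClosure (Z : Set (Plane k)) : Set (Plane k) :=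
  {P | ∀ F ∈ idealOf Z, MvPolynomial.eval P.rep F = 0}

/-- `F` is a (reduced) defining polynomial of the plane curve `Z`: a nonzero homogeneous polynomial
with zero set `Z` that generates the ideal of `Z`. -/
structure IsDefiningPolynomial (F : MvPolynomial (Fin 3) k) (Z : Set (Plane k)) : Prop where
  ne_zero : F ≠ 0
  isHomogeneous : ∃ n : ℕ, F.IsHomogeneous n
  locus_eq : locus F = Z
  span_eq : Ideal.span {F} = idealOf Z

/-- The gradient of `F` at `v`. -/
def gradient (F : MvPolynomial (Fin 3) k) (v : Fin 3 → k) : Fin 3 → k :=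
  fun i => MvPolynomial.eval v (MvPolynomial.pderiv i F)

/-- The dual curve of the plane curve `F = 0` (with `F` homogeneous and squarefree): the closure of
the image of the Gauss map, which sends a smooth point `P` to `[∂F/∂x₀ : ∂F/∂x₁ : ∂F/∂x₂]` at `P`,
the tangent line at `P`. -/
def dualCurve (F : MvPolynomial (Fin 3) k) : Set (Plane k) :=
  zariskiClosure {Q | ∃ P ∈ locus F, ∃ h : gradient F P.rep ≠ 0,
    Q = Projectivization.mk k (gradient F P.rep) h}

/-- The morphism `γ_d : [x₀ : x₁ : x₂] ↦ [x₀^d : x₁^d : x₂^d]`. -/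
def powerMap (d : ℕ) : Plane k → Plane k :=
  Projectivization.lift
    (fun v : {v : Fin 3 → k // v ≠ 0} => Projectivization.mk k (fun i => v.1 i ^ d) (by
      obtain ⟨i, hi⟩ := Function.ne_iff.mp v.2
      exact Function.ne_iff.mpr ⟨i, pow_ne_zero d hi⟩))
    (by
      intro a b t h
      refine (Projectivization.mk_eq_mk_iff' k _ _ _ _).mpr ⟨t ^ d, ?_⟩
      funext i
      simp [h, mul_pow])

/-- The polynomial `x₀^d + x₁^d + x₂^d`, which defines the Fermat curve of degree `d`. -/
def fermat (k : Type*) [Field k] (d : ℕ) : MvPolynomial (Fin 3) k :=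
  ∑ i, MvPolynomial.X i ^ d

/-- The Ballico–Hefez curve: the image of the line `x₀ + x₁ + x₂ = 0` under `γ_{q+1}`. -/
def ballicoHefez (k : Type*) [Field k] (q : ℕ) : Set (Plane k) :=
  powerMap (q + 1) '' locus (∑ i, MvPolynomial.X i : MvPolynomial (Fin 3) k)

/-- `P` is a singular point of the plane curve `Z` (Jacobian criterion). -/
def IsSingularPoint (Z : Set (Plane k)) (P : Plane k) : Prop :=
  P ∈ Z ∧ ∀ F ∈ idealOf Z, gradient F P.rep = 0

/-- For `v i ≠ 0`, the polynomial `F` dehomogenized by `x_i = 1`, in the two affine coordinates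
of that chart, translated so that the point `[v]` becomes the origin. -/
def localPolynomial (F : MvPolynomial (Fin 3) k) (v : Fin 3 → k) (i : Fin 3) :
    MvPolynomial (Fin 2) k :=
  MvPolynomial.aeval
    (Fin.insertNth (α := fun _ => MvPolynomial (Fin 2) k) i 1
      (fun j => MvPolynomial.X j + MvPolynomial.C (v (i.succAbove j) / v i))) F

/-- `f ∈ k⟦x, y⟧` is a local equation of the plane curve `Z` at `P`, in the coordinates of one of
the standard affine charts around `P`. A local equation is determined only up to units. -/
def IsLocalEquation (Z : Set (Plane k)) (P : Plane k) (f : MvPowerSeries (Fin 2) k) : Prop :=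
  ∃ F : MvPolynomial (Fin 3) k, IsDefiningPolynomial F Z ∧
    ∃ i : Fin 3, P.rep i ≠ 0 ∧ ∃ u : (MvPowerSeries (Fin 2) k)ˣ,
      f = (u : MvPowerSeries (Fin 2) k) * (localPolynomial F P.rep i : MvPowerSeries (Fin 2) k)

/-- `P` is an ordinary node of the plane curve `Z`: a double point whose tangent cone is a pair of
distinct lines, that is, a local equation agrees modulo terms of order at least `3` with a
product of two linearly independent linear forms. -/
def IsOrdinaryNode (Z : Set (Plane k)) (P : Plane k) : Prop :=
  P ∈ Z ∧ ∃ f : MvPowerSeries (Fin 2) k, IsLocalEquation Z P f ∧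
    ∃ a b c d : k, a * d ≠ b * c ∧
      f - (MvPowerSeries.C a * MvPowerSeries.X 0 + MvPowerSeries.C b * MvPowerSeries.X 1) *
          (MvPowerSeries.C c * MvPowerSeries.X 0 + MvPowerSeries.C d * MvPowerSeries.X 1) ∈
        (Ideal.span {MvPowerSeries.X 0, MvPowerSeries.X 1} :
          Ideal (MvPowerSeries (Fin 2) k)) ^ 3

/-- The Milnor number `dim k⟦x, y⟧ / (∂f/∂x, ∂f/∂y)` of a power series (possibly infinite). -/
def milnorNumber (f : MvPowerSeries (Fin 2) k) : ℕ∞ :=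
  Cardinal.toENat (Module.rank k (MvPowerSeries (Fin 2) k ⧸
    (Ideal.span {MvPowerSeries.pderiv k 0 f, MvPowerSeries.pderiv k 1 f} :
      Ideal (MvPowerSeries (Fin 2) k))))

/-- The plane curve `Z` has Milnor number `m` at `P`: it has a local equation there, and every
local equation has Milnor number `m`. (In positive characteristic the Milnor number of a power
series can change when the series is multiplied by a unit, so independence is part of this.) -/
def HasMilnorNumber (Z : Set (Plane k)) (P : Plane k) (m : ℕ∞) : Prop :=
  (∃ f, IsLocalEquation Z P f) ∧ ∀ f, IsLocalEquation Z P f → milnorNumber f = m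

end PlaneCurve

end

noncomputable section

namespace PlaneCurve

/-! ### The equation of the Ballico–Hefez curve -/

/-! The proof rests on the double cover of the plane by `ℙ¹ × ℙ¹` sending `([a:c], [b:e])` to
`[(a+c)(b+e) : ab : ce]`, the quotient by the swap of the factors. The three coordinates are norms
of the linear forms `a + c`, `a`, `c`, so a point of the line `x₀ + x₁ + x₂ = 0`, raised to the
power `q + 1 = 1 + q`, is the image of a pair (point, Frobenius of the point). The curve `B` is
therefore the image of the graph of Frobenius. Its equation `h` is the product of the equations of
the graph and its transpose, written in symmetric functions by a Lucas sequence
(`aeval_ballicoHefezPoly_quadric`).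

(i) On the Fermat curve the Gauss map is `x ↦ x^(d-1)` with `d - 1 = q(q+1)`. The `d`-th powers of
the image are the `(q+1)`-st powers of `(x_i^d)^q`, which sum to zero. Conversely `y^d = z^(d-1)`
with `∑ z_i = 0` is solved by `x = z/y` (`gaussImage_fermat`). The image is already closed. The
pulled-back equation is reduced because, up to sign, it is monic in `x₀` and separable in `x₀` for
generic values of the other variables (`expand_ballicoHefezPoly_dvd`).

(ii) Frobenius powers have zero derivative, so the gradient of `h` is explicit on the cover. It
vanishes exactly at the conjugate pairs `a = b^q`, `b = a^q`, `a ≠ b`, of which `(q²-q)/2` are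
distinct as unordered pairs. Moreover `h` is a quadratic form in its own gradient
(`eval_eq_quadratic_gradient`), and the Hessian at such a point is invertible, so these points are
nodes. Since `d = 1` in `k`, the power map is étale off the axes and each node has `d²` preimages,
all nodes. Each axis meets `B` in a single point, smooth on `B`, with contact of order `q + 1`.
Above it lie `d` points with local equation `-(yω)^(q+1) + x^d r`, where `ω` and `r` are units; the
partial derivatives generate `(x^(q(q+1)), y^q)`, even after multiplication by a unit
(`milnorNumber_mul_unit`). -/

/-- The Lucas sequence `V_m`, which expresses the power sum `a ^ m + b ^ m` through `T = a + b` and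
`e = a * b`. -/
def lucasV {R : Type*} [CommRing R] (T e : R) : ℕ → R
  | 0 => 2
  | 1 => T
  | m + 2 => T * lucasV T e (m + 1) - e * lucasV T e m

theorem lucasV_add_mul {R : Type*} [CommRing R] (a b : R) :
    ∀ m, lucasV (a + b) (a * b) m = a ^ m + b ^ m
  | 0 => by norm_num [lucasV]
  | 1 => by simp [lucasV]
  | m + 2 => by
    rw [lucasV, lucasV_add_mul a b (m + 1), lucasV_add_mul a b m]
    ring

theorem map_lucasV {R S : Type*} [CommRing R] [CommRing S] (f : R →+* S) (T e : R) :
    ∀ m, f (lucasV T e m) = lucasV (f T) (f e) m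
  | 0 => map_ofNat f 2
  | 1 => rfl
  | m + 2 => by simp [lucasV, map_lucasV f T e (m + 1), map_lucasV f T e m]

theorem lucasV_isHomogeneous {σ R : Type*} [CommRing R] {T e : MvPolynomial σ R}
    (hT : T.IsHomogeneous 1) (he : e.IsHomogeneous 2) : ∀ m, (lucasV T e m).IsHomogeneous m
  | 0 => MvPolynomial.isHomogeneous_C σ (2 : R)
  | 1 => hT
  | m + 2 => by
    have h1 := hT.mul (lucasV_isHomogeneous hT he (m + 1))
    have h2 := he.mul (lucasV_isHomogeneous hT he m)
    rw [show 1 + (m + 1) = m + 2 by ring] at h1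
    rw [show 2 + m = m + 2 by ring] at h2
    exact h1.sub h2

open Polynomial in
theorem lucasV_monic {R : Type*} [CommRing R] [Nontrivial R] {T : R[X]} (hT : T.Monic)
    (hT0 : 0 < T.natDegree) (c : R) : ∀ m,
      (lucasV T (C c) (m + 1)).Monic ∧
        (lucasV T (C c) (m + 1)).natDegree = (m + 1) * T.natDegree
  | 0 => by simp [lucasV, hT]
  -- A separate base case is needed because `V_0 = 2` is a constant and not monic, so the recursion
  -- for `V_2` cannot use it.
  | 1 => by
    have h : lucasV T (C c) 2 = T * T - C (c * 2) := by
      rw [C_mul]; rfl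
    have hd : (T * T).natDegree = 2 * T.natDegree := by rw [hT.natDegree_mul hT]; ring
    have hlt : (C (c * 2)).degree < (T * T).degree := by
      refine lt_of_le_of_lt degree_C_le ?_
      rw [← natDegree_pos_iff_degree_pos]
      omega
    refine ⟨?_, ?_⟩
    · rw [h]; exact (hT.mul hT).sub_of_left hlt
    · rw [h, natDegree_sub_eq_left_of_natDegree_lt, hd]
      rw [natDegree_C]; omega
  | m + 2 => by
    obtain ⟨h1, d1⟩ := lucasV_monic hT hT0 c (m + 1)
    obtain ⟨h0, d0⟩ := lucasV_monic hT hT0 c m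
    have h : lucasV T (C c) (m + 2 + 1) =
        T * lucasV T (C c) (m + 1 + 1) - C c * lucasV T (C c) (m + 1) := rfl
    have hd : (T * lucasV T (C c) (m + 1 + 1)).natDegree = (m + 2 + 1) * T.natDegree := by
      rw [hT.natDegree_mul h1, d1]; ring
    have hlt : (C c * lucasV T (C c) (m + 1)).natDegree <
        (T * lucasV T (C c) (m + 1 + 1)).natDegree := by
      refine lt_of_le_of_lt (natDegree_C_mul_le _ _) ?_
      rw [hd, d0]
      exact Nat.mul_lt_mul_of_pos_right (by omega) hT0
    refine ⟨?_, ?_⟩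
    · rw [h]
      exact (hT.mul h1).sub_of_left (degree_lt_degree hlt)
    · rw [h, natDegree_sub_eq_left_of_natDegree_lt hlt, hd]

open MvPolynomial

/-- The homogeneous equation of degree `q + 1` of the Ballico–Hefez curve. -/
def ballicoHefezPoly (k : Type*) [Field k] (q : ℕ) : MvPolynomial (Fin 3) k :=
  X 1 * X 2 ^ q + X 1 ^ q * X 2 - lucasV (X 0 - X 1 - X 2) (X 1 * X 2) (q + 1)

theorem ballicoHefezPoly_isHomogeneous (k : Type*) [Field k] (q : ℕ) :
    (ballicoHefezPoly k q).IsHomogeneous (q + 1) := by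
  have hX : ∀ i : Fin 3, (X i : MvPolynomial (Fin 3) k).IsHomogeneous 1 := isHomogeneous_X k
  have h1 := (hX 1).mul ((hX 2).pow q)
  have h2 := ((hX 1).pow q).mul (hX 2)
  rw [show 1 + 1 * q = q + 1 by ring] at h1
  rw [show 1 * q + 1 = q + 1 by ring] at h2
  exact (h1.add h2).sub
    (lucasV_isHomogeneous (((hX 0).sub (hX 1)).sub (hX 2)) ((hX 1).mul (hX 2)) _)

theorem aeval_ballicoHefezPoly {k A : Type*} [Field k] [CommRing A] [Algebra k A] (q : ℕ)
    (f : Fin 3 → A) : aeval f (ballicoHefezPoly k q) =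
      f 1 * f 2 ^ q + f 1 ^ q * f 2 - lucasV (f 0 - f 1 - f 2) (f 1 * f 2) (q + 1) := by
  have h := map_lucasV (aeval f : MvPolynomial (Fin 3) k →ₐ[k] A).toRingHom (X 0 - X 1 - X 2)
    (X 1 * X 2) (q + 1)
  simp only [AlgHom.toRingHom_eq_coe, RingHom.coe_coe, map_sub, map_mul, aeval_X] at h
  simp [ballicoHefezPoly, h]

/-- The pullback of the Ballico–Hefez curve under `ℙ¹ × ℙ¹ → ℙ²` splits into the graph of Frobenius
and its transpose. -/
theorem aeval_ballicoHefezPoly_quadric {k A : Type*} [Field k] [CommRing A] [Algebra k A] (q : ℕ)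
    (a b c e : A) : aeval ![(a + c) * (b + e), a * b, c * e] (ballicoHefezPoly k q) =
      (b * c ^ q - a ^ q * e) * (a * e ^ q - b ^ q * c) := by
  rw [aeval_ballicoHefezPoly]
  have h : lucasV ((a + c) * (b + e) - a * b - c * e) (a * b * (c * e)) (q + 1) =
      (a * e) ^ (q + 1) + (b * c) ^ (q + 1) := by
    rw [← lucasV_add_mul]; congr 1 <;> ring
  simp only [Matrix.cons_val_zero, Matrix.cons_val_one, Matrix.cons_val]
  rw [h]
  ring

theorem eval_ballicoHefezPoly_quadric {k : Type*} [Field k] (q : ℕ)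
    (a b c e : k) : eval ![(a + c) * (b + e), a * b, c * e] (ballicoHefezPoly k q) =
      (b * c ^ q - a ^ q * e) * (a * e ^ q - b ^ q * c) := by
  rw [← aeval_ballicoHefezPoly_quadric (k := k), aeval_eq_eval]

/-- The chain rule for a derivation applied to a substitution. -/
theorem derivation_aeval {k A σ : Type*} [Field k] [CommRing A] [Algebra k A] [Fintype σ]
    (D : Derivation k A A) (f : σ → A) (F : MvPolynomial σ k) :
    D (aeval f F) = ∑ i, aeval f (pderiv i F) * D (f i) := by
  classical
  induction F using MvPolynomial.induction_on with
  | C a => simp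
  | add p q hp hq => simp [hp, hq, add_mul, Finset.sum_add_distrib]
  | mul_X p i hp =>
    simp only [map_mul, aeval_X, Derivation.leibniz, hp, smul_eq_mul, pderiv_X, map_add, add_mul,
      Finset.sum_add_distrib, Finset.mul_sum]
    congr 1
    · rw [Finset.sum_eq_single i] <;> simp +contextual [eq_comm]
    · exact Finset.sum_congr rfl fun j _ => by ring

section Frobenius

variable {k : Type*} [Field k] {p n q : ℕ} [CharP k p]

theorem natCast_frobenius_eq_zero (hn : 0 < n) (hq : q = p ^ n) : (q : k) = 0 := by
  rw [hq, Nat.cast_pow, CharP.cast_eq_zero, zero_pow hn.ne']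

variable [Fact p.Prime]

theorem add_pow_frobenius (hq : q = p ^ n) (x y : k) : (x + y) ^ q = x ^ q + y ^ q := by
  rw [hq, add_pow_char_pow]

theorem sub_pow_frobenius (hq : q = p ^ n) (x y : k) : (x - y) ^ q = x ^ q - y ^ q := by
  rw [hq, sub_pow_char_pow]

theorem neg_pow_frobenius (hq : q = p ^ n) (x : k) : (-x) ^ q = -x ^ q := by
  have := sub_pow_frobenius (n := n) (p := p) hq 0 x
  have hq0 : q ≠ 0 := by rw [hq]; exact pow_ne_zero _ (Fact.out : p.Prime).ne_zero
  simpa [zero_pow hq0] using this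

end Frobenius

section Closed

variable {k : Type*} [Field k] [IsAlgClosed k]

theorem exists_add_mul_eq (s t : k) : ∃ a b : k, a + b = s ∧ a * b = t := by
  obtain ⟨a, ha⟩ := IsAlgClosed.exists_root
    (Polynomial.X ^ 2 - Polynomial.C s * Polynomial.X + Polynomial.C t) (by
      have : (Polynomial.X ^ 2 - Polynomial.C s * Polynomial.X + Polynomial.C t).degree = 2 := by
        compute_degree!
      rw [this]; norm_num)
  refine ⟨a, s - a, by ring, ?_⟩
  simp [Polynomial.IsRoot] at ha
  linear_combination -ha

/-- The points off the line `x₂ = 0` in the image of the quadric. -/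
theorem exists_quadric_eq (x y c : k) (hc : c ≠ 0) :
    ∃ a b : k, x = (a + c) * (b + c) ∧ y = a * b := by
  obtain ⟨a, b, h1, h2⟩ := exists_add_mul_eq ((x - y - c * c) / c) y
  refine ⟨a, b, ?_, h2.symm⟩
  field_simp at h1
  linear_combination -h1 - h2

theorem exists_vec_eq_quadric (v : Fin 3 → k) :
    ∃ a b c e : k, v = ![(a + c) * (b + e), a * b, c * e] := by
  by_cases hc : v 2 = 0
  · refine ⟨1, v 1, 0, v 0 - v 1, ?_⟩
    ext i; fin_cases i <;> simp [hc]
  · obtain ⟨c, hcc⟩ := IsAlgClosed.exists_pow_nat_eq (v 2) (n := 2) (by norm_num)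
    obtain ⟨a, b, h0, h1⟩ := exists_quadric_eq (v 0) (v 1) c (by
      rintro rfl; simp at hcc; simp [← hcc] at hc)
    refine ⟨a, b, c, c, ?_⟩
    ext i; fin_cases i <;> simp [h0, h1, ← hcc, pow_two]

variable {p n q : ℕ} [Fact p.Prime] [CharP k p]

/-- The coordinates are norms of the forms `a`, `c`, `-(a + c)`, which sum to zero. Permuting these
forms cyclically is a linear change of variables over the prime field, and it commutes with
Frobenius. -/
theorem eval_ballicoHefezPoly_cyclic (hq : q = p ^ n) (x y z : k) :
    eval ![x, y, z] (ballicoHefezPoly k q) = eval ![y, z, x] (ballicoHefezPoly k q) := by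
  obtain ⟨a, b, c, e, h⟩ := exists_vec_eq_quadric ![x, y, z]
  have hx : x = (a + c) * (b + e) := by simpa using congrFun h 0
  have hy : y = a * b := by simpa using congrFun h 1
  have hz : z = c * e := by simpa using congrFun h 2
  have h2 : ![y, z, x] = ![(c + -(a + c)) * (e + -(b + e)), c * e, -(a + c) * -(b + e)] := by
    rw [hx, hy, hz]; ext i; fin_cases i <;> simp; ring
  rw [h, h2, eval_ballicoHefezPoly_quadric, eval_ballicoHefezPoly_quadric,
    neg_pow_frobenius hq, neg_pow_frobenius hq, add_pow_frobenius hq, add_pow_frobenius hq]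
  ring

/-- The cone over the Ballico–Hefez curve is the zero set of its equation. -/
theorem eval_ballicoHefezPoly_eq_zero_iff (hq : q = p ^ n) (v : Fin 3 → k) :
    eval v (ballicoHefezPoly k q) = 0 ↔
      ∃ w : Fin 3 → k, w 0 + w 1 + w 2 = 0 ∧ ∀ i, v i = w i ^ (q + 1) := by
  constructor
  · intro hv
    by_cases hc : v 2 = 0
    · have h : v = ![(1 + 0) * (v 1 + (v 0 - v 1)), 1 * v 1, 0 * (v 0 - v 1)] := by
        ext i; fin_cases i <;> simp [hc]
      have hq0 : q ≠ 0 := by rw [hq]; exact pow_ne_zero _ (Fact.out : p.Prime).ne_zero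
      rw [h, eval_ballicoHefezPoly_quadric] at hv
      have h01 : v 1 = v 0 ∨ v 0 = v 1 := by
        simpa [hq0, sub_eq_zero] using hv
      replace h01 : v 0 = v 1 := h01.elim Eq.symm id
      obtain ⟨t, ht⟩ := IsAlgClosed.exists_pow_nat_eq (v 1) (n := q + 1) (by omega)
      refine ⟨![-t, t, 0], by simp, fun i => ?_⟩
      fin_cases i
      · simp only [Fin.zero_eta, Matrix.cons_val_zero]
        rw [pow_succ, neg_pow_frobenius hq, h01, ← ht]; ring
      · exact ht.symm
      · simpa using hc
    · obtain ⟨c, hcc⟩ := IsAlgClosed.exists_pow_nat_eq (v 2) (n := 2) (by norm_num)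
      have hc0 : c ≠ 0 := by rintro rfl; simp at hcc; simp [← hcc] at hc
      obtain ⟨t, ht⟩ := IsAlgClosed.exists_pow_nat_eq (v 2) (n := q + 1) (by omega)
      obtain ⟨a, b, h0, h1⟩ := exists_quadric_eq (v 0) (v 1) c hc0
      have hvec : v = ![(a + c) * (b + c), a * b, c * c] := by
        ext i; fin_cases i <;> simp [h0, h1, ← hcc, pow_two]
      -- Exchanging `a` and `b` swaps the two factors of the equation and fixes the point, so one
      -- factor suffices.
      have key : ∀ a b : k, v 0 = (a + c) * (b + c) → v 1 = a * b → b * c ^ q = a ^ q * c →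
          ∃ w : Fin 3 → k, w 0 + w 1 + w 2 = 0 ∧ ∀ i, v i = w i ^ (q + 1) := by
        intro a b h0 h1 h
        have hb : b / c = (a / c) ^ q := by
          rw [div_pow]; field_simp; linear_combination h
        have hb' : b = c * (a / c) ^ q := by rw [← hb]; field_simp
        have hcc' : c * c = t ^ (q + 1) := by rw [ht, ← hcc, pow_two]
        have e1 : v 1 = (t * (a / c)) ^ (q + 1) := by
          rw [h1, mul_pow, ← hcc', pow_succ (a / c), ← hb]; field_simp
        have e0 : v 0 = (-(t * (a / c) + t)) ^ (q + 1) := by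
          rw [h0, show -(t * (a / c) + t) = t * (-(a / c + 1)) by ring, mul_pow, ← hcc',
            pow_succ (-(a / c + 1)), neg_pow_frobenius hq, add_pow_frobenius hq, ← hb, one_pow]
          field_simp
        refine ⟨![-(t * (a / c) + t), t * (a / c), t], by simp, fun i => ?_⟩
        fin_cases i
        · exact e0
        · exact e1
        · exact ht.symm
      rw [hvec, eval_ballicoHefezPoly_quadric, mul_eq_zero] at hv
      rcases hv with hv | hv
      · exact key a b h0 h1 (by linear_combination hv)
      · exact key b a (by rw [h0]; ring) (by rw [h1]; ring) (by linear_combination hv)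
  · rintro ⟨w, hw, h⟩
    have hw0 : w 0 = -(w 1 + w 2) := by linear_combination hw
    -- This is the quadric point with first factor `[w₁^q : w₂^q]` and second factor `[w₁ : w₂]`,
    -- which lies on the graph of Frobenius.
    have hvec : v = ![(w 1 ^ q + w 2 ^ q) * (w 1 + w 2), w 1 ^ q * w 1, w 2 ^ q * w 2] := by
      ext i; fin_cases i
      · simp only [h, hw0, Fin.zero_eta, Matrix.cons_val_zero]
        rw [pow_succ, neg_pow_frobenius hq, add_pow_frobenius hq]
        ring
      · simp [h, pow_succ]
      · simp [h, pow_succ]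
    rw [hvec, eval_ballicoHefezPoly_quadric]
    ring

end Closed

/-! ### Partial derivatives of the equation -/

theorem one_lt_frobenius {p n q : ℕ} [Fact p.Prime] (hn : 0 < n) (hq : q = p ^ n) : 1 < q :=
  hq ▸ one_lt_pow₀ (Fact.out : p.Prime).one_lt hn.ne'

section Gradient

variable {k : Type*} [Field k] {p n q : ℕ} [CharP k p]

/-- Differentiate the factored equation in the second variable. Since `q = 0` in `k`, only the term
`b c^q` contributes, and the chain rule gives the left side. -/
theorem quadric_pderiv_one (hn : 0 < n) (hq : q = p ^ n) (c : k) :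
    aeval ![(X 0 + C c) * (X 1 + C c), X 0 * X 1, C c * C c] (pderiv 0 (ballicoHefezPoly k q)) *
        (X 0 + C c) +
      aeval ![(X 0 + C c) * (X 1 + C c), X 0 * X 1, C c * C c] (pderiv 1 (ballicoHefezPoly k q)) *
        X 0 = (C c ^ q * (X 0 * C c ^ q - X 1 ^ q * C c) : MvPolynomial (Fin 2) k) := by
  have hq0 : (q : MvPolynomial (Fin 2) k) = 0 := by
    rw [← map_natCast (C : k →+* _), natCast_frobenius_eq_zero hn hq, map_zero]
  have h := derivation_aeval (pderiv (1 : Fin 2))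
    ![(X 0 + C c) * (X 1 + C c), X 0 * X 1, C c * C c] (ballicoHefezPoly k q)
  rw [aeval_ballicoHefezPoly_quadric, Fin.sum_univ_three] at h
  simp [Derivation.leibniz, Derivation.leibniz_pow, hq0, -aeval_eq_bind₁] at h
  rw [← h]
  ring

theorem quadric_pderiv_zero (hn : 0 < n) (hq : q = p ^ n) (c : k) :
    aeval ![(X 0 + C c) * (X 1 + C c), X 0 * X 1, C c * C c] (pderiv 0 (ballicoHefezPoly k q)) *
        (X 1 + C c) +
      aeval ![(X 0 + C c) * (X 1 + C c), X 0 * X 1, C c * C c] (pderiv 1 (ballicoHefezPoly k q)) *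
        X 1 = (C c ^ q * (X 1 * C c ^ q - X 0 ^ q * C c) : MvPolynomial (Fin 2) k) := by
  have hq0 : (q : MvPolynomial (Fin 2) k) = 0 := by
    rw [← map_natCast (C : k →+* _), natCast_frobenius_eq_zero hn hq, map_zero]
  have h := derivation_aeval (pderiv (0 : Fin 2))
    ![(X 0 + C c) * (X 1 + C c), X 0 * X 1, C c * C c] (ballicoHefezPoly k q)
  rw [aeval_ballicoHefezPoly_quadric, Fin.sum_univ_three] at h
  simp [Derivation.leibniz, Derivation.leibniz_pow, hq0, -aeval_eq_bind₁] at h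
  rw [← h]
  ring

theorem eval_aeval_quadric (a b c : k) (F : MvPolynomial (Fin 3) k) :
    eval ![a, b] (aeval ![(X 0 + C c) * (X 1 + C c), X 0 * X 1, C c * C c] F) =
      eval ![(a + c) * (b + c), a * b, c * c] F := by
  rw [← aeval_eq_eval, ← aeval_eq_eval, ← AlgHom.comp_apply, comp_aeval]
  congr 2
  ext i; fin_cases i <;> simp

theorem eval_quadric_pderiv_one (hn : 0 < n) (hq : q = p ^ n) (a b c : k) :
    eval ![(a + c) * (b + c), a * b, c * c] (pderiv 0 (ballicoHefezPoly k q)) * (a + c) +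
      eval ![(a + c) * (b + c), a * b, c * c] (pderiv 1 (ballicoHefezPoly k q)) * a =
        c ^ q * (a * c ^ q - b ^ q * c) := by
  have := congrArg (eval ![a, b]) (quadric_pderiv_one hn hq c)
  simp only [map_add, map_mul, eval_aeval_quadric] at this
  simpa using this

theorem eval_quadric_pderiv_zero (hn : 0 < n) (hq : q = p ^ n) (a b c : k) :
    eval ![(a + c) * (b + c), a * b, c * c] (pderiv 0 (ballicoHefezPoly k q)) * (b + c) +
      eval ![(a + c) * (b + c), a * b, c * c] (pderiv 1 (ballicoHefezPoly k q)) * b =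
        c ^ q * (b * c ^ q - a ^ q * c) := by
  have := congrArg (eval ![a, b]) (quadric_pderiv_zero hn hq c)
  simp only [map_add, map_mul, eval_aeval_quadric] at this
  simpa using this

variable [Fact p.Prime]

/-- The difference of the two derivative identities is `(a - b)` times the sum of the partials, and
equals `(a - b) + (a - b)^q`. The factor is cancelled in the polynomial ring, so the result holds on
the diagonal `a = b` too. -/
theorem eval_quadric_pderiv_add (hn : 0 < n) (hq : q = p ^ n) (a b : k) :
    eval ![(a + 1) * (b + 1), a * b, 1] (pderiv 0 (ballicoHefezPoly k q)) +
      eval ![(a + 1) * (b + 1), a * b, 1] (pderiv 1 (ballicoHefezPoly k q)) =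
        1 + (a - b) ^ (q - 1) := by
  have h1 := quadric_pderiv_one hn hq (1 : k)
  have h0 := quadric_pderiv_zero hn hq (1 : k)
  have hne : (X 0 - X 1 : MvPolynomial (Fin 2) k) ≠ 0 := by
    intro h
    have := congrArg (eval ![1, 0]) h
    simp at this
  have hs : (X 0 - X 1 : MvPolynomial (Fin 2) k) ^ q = X 0 ^ q - X 1 ^ q := by
    rw [hq, sub_pow_char_pow]
  have hs' : (X 0 - X 1 : MvPolynomial (Fin 2) k) ^ q = (X 0 - X 1) * (X 0 - X 1) ^ (q - 1) := by
    rw [← pow_succ', Nat.sub_add_cancel (one_lt_frobenius hn hq).le]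
  have key := mul_left_cancel₀ hne (a := X 0 - X 1)
    (b := aeval ![(X 0 + C 1) * (X 1 + C 1), X 0 * X 1, C 1 * C 1]
        (pderiv 0 (ballicoHefezPoly k q)) +
      aeval ![(X 0 + C 1) * (X 1 + C 1), X 0 * X 1, C 1 * C 1]
        (pderiv 1 (ballicoHefezPoly k q))) (c := 1 + (X 0 - X 1) ^ (q - 1)) (by
      rw [mul_add _ 1, ← hs', hs]
      simp only [C_1, one_pow] at h0 h1 ⊢
      linear_combination h1 - h0)
  have := congrArg (eval ![a, b]) key
  simp only [map_add, eval_aeval_quadric] at this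
  simpa using this

/-- The derivative identities form a linear system for the two partials with determinant `±(a - b)`.
Off the diagonal it can be inverted; on the diagonal the sum of the partials is `1`, so they cannot
both vanish. -/
theorem gradient_quadric_eq_zero_iff (hn : 0 < n) (hq : q = p ^ n) (a b : k) :
    (eval ![(a + 1) * (b + 1), a * b, 1] (pderiv 0 (ballicoHefezPoly k q)) = 0 ∧
      eval ![(a + 1) * (b + 1), a * b, 1] (pderiv 1 (ballicoHefezPoly k q)) = 0) ↔
        a = b ^ q ∧ b = a ^ q ∧ a ≠ b := by
  have h1 := eval_quadric_pderiv_one hn hq a b 1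
  have h0 := eval_quadric_pderiv_zero hn hq a b 1
  have hs := eval_quadric_pderiv_add hn hq a b
  simp only [one_pow, mul_one, one_mul] at h0 h1
  constructor
  · rintro ⟨e0, e1⟩
    rw [e0, e1] at h0 h1 hs
    refine ⟨by linear_combination -h1, by linear_combination -h0, ?_⟩
    rintro rfl
    have := one_lt_frobenius hn hq
    simp [zero_pow (show q - 1 ≠ 0 by omega)] at hs
  · rintro ⟨ha, hb, hab⟩
    rw [← sub_eq_zero] at ha hb
    rw [ha] at h1
    rw [hb] at h0
    have hab' := sub_ne_zero.mpr hab
    constructor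
    · refine (mul_eq_zero.mp (?_ : (a - b) * _ = 0)).resolve_left hab'
      linear_combination a * h0 - b * h1
    · refine (mul_eq_zero.mp (?_ : (a - b) * _ = 0)).resolve_left hab'
      linear_combination (b + 1) * h1 - (a + 1) * h0

/-- The Hessian of the affine equation at a node of the Ballico–Hefez curve is invertible. -/
theorem hessian_quadric_ne_zero (hn : 0 < n) (hq : q = p ^ n) {a b : k} (ha : a = b ^ q)
    (hb : b = a ^ q) (hab : a ≠ b) :
    eval ![(a + 1) * (b + 1), a * b, 1] (pderiv 0 (pderiv 0 (ballicoHefezPoly k q))) *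
        eval ![(a + 1) * (b + 1), a * b, 1] (pderiv 1 (pderiv 1 (ballicoHefezPoly k q))) ≠
      eval ![(a + 1) * (b + 1), a * b, 1] (pderiv 1 (pderiv 0 (ballicoHefezPoly k q))) *
        eval ![(a + 1) * (b + 1), a * b, 1] (pderiv 0 (pderiv 1 (ballicoHefezPoly k q))) := by
  obtain ⟨g0, g1⟩ := (gradient_quadric_eq_zero_iff hn hq a b).mpr ⟨ha, hb, hab⟩
  have hq0 : (q : MvPolynomial (Fin 2) k) = 0 := by
    rw [← map_natCast (C : k →+* _), natCast_frobenius_eq_zero hn hq, map_zero]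
  have key : ∀ (i : Fin 2) (F : MvPolynomial (Fin 3) k), eval ![a, b] (pderiv i
      (aeval ![(X 0 + C 1) * (X 1 + C 1), X 0 * X 1, C 1 * C 1] F)) =
      eval ![(a + 1) * (b + 1), a * b, 1] (pderiv 0 F) * ![b + 1, a + 1] i +
        eval ![(a + 1) * (b + 1), a * b, 1] (pderiv 1 F) * ![b, a] i := by
    intro i F
    rw [derivation_aeval, map_sum, Fin.sum_univ_three]
    simp only [map_mul, eval_aeval_quadric, mul_one]
    fin_cases i <;> simp [Derivation.leibniz]
  have h1 := quadric_pderiv_one hn hq (1 : k)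
  have h0 := quadric_pderiv_zero hn hq (1 : k)
  have e : ∀ i : Fin 3, eval ![a, b] (aeval ![(X 0 + C 1) * (X 1 + C 1), X 0 * X 1, C 1 * C 1]
      (pderiv i (ballicoHefezPoly k q))) =
      eval ![(a + 1) * (b + 1), a * b, 1] (pderiv i (ballicoHefezPoly k q)) := by
    intro i; rw [eval_aeval_quadric, mul_one]
  have h10 := congrArg (fun F => eval ![a, b] (pderiv 0 F)) h1
  have h11 := congrArg (fun F => eval ![a, b] (pderiv 1 F)) h1
  have h00 := congrArg (fun F => eval ![a, b] (pderiv 0 F)) h0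
  have h01 := congrArg (fun F => eval ![a, b] (pderiv 1 F)) h0
  simp only [map_add, Derivation.leibniz, smul_eq_mul, map_mul, key, e, g0, g1] at h10 h11 h00 h01
  simp [Derivation.leibniz_pow, hq0] at h10 h11 h00 h01
  -- Since the first partials vanish here, the Hessian of the pullback is the Hessian of `h`
  -- conjugated by the Jacobian of the cover, of determinant `±(a - b)`. It has zero diagonal and
  -- off-diagonal entries `1`, so `(b - a)²` times the Hessian determinant is `-1`.
  intro hdet
  refine one_ne_zero (α := k) ?_
  generalize eval ![(a + 1) * (b + 1), a * b, 1] (pderiv 0 (pderiv 0 (ballicoHefezPoly k q))) = r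
    at *
  generalize eval ![(a + 1) * (b + 1), a * b, 1] (pderiv 1 (pderiv 0 (ballicoHefezPoly k q))) = s
    at *
  generalize eval ![(a + 1) * (b + 1), a * b, 1] (pderiv 0 (pderiv 1 (ballicoHefezPoly k q))) = t
    at *
  generalize eval ![(a + 1) * (b + 1), a * b, 1] (pderiv 1 (pderiv 1 (ballicoHefezPoly k q))) = u
    at *
  linear_combination -((b + 1) * (r * (a + 1) + s * a) + b * (t * (a + 1) + u * a)) * h10 - h01 +
    ((a + 1) * (r * (a + 1) + s * a) + a * (t * (a + 1) + u * a)) * h00 -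
    (b - a) ^ 2 * hdet

end Gradient

section Closed

variable {k : Type*} [Field k] [IsAlgClosed k] {p n q : ℕ} [CharP k p]

/-- Both factors of the pulled-back equation are linear in the partials by the derivative
identities. Their product has coefficients `(a+1)(b+1) = x`, `ab = y` and `(a+1)b + a(b+1) = x + y -
1`, symmetric in `a` and `b`. -/
theorem eval_eq_quadratic_gradient (hn : 0 < n) (hq : q = p ^ n) (x y : k) :
    eval ![x, y, 1] (ballicoHefezPoly k q) =
      x * eval ![x, y, 1] (pderiv 0 (ballicoHefezPoly k q)) ^ 2 +
      (x + y - 1) * eval ![x, y, 1] (pderiv 0 (ballicoHefezPoly k q)) *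
        eval ![x, y, 1] (pderiv 1 (ballicoHefezPoly k q)) +
      y * eval ![x, y, 1] (pderiv 1 (ballicoHefezPoly k q)) ^ 2 := by
  obtain ⟨a, b, hx, hy⟩ := exists_quadric_eq x y (1 : k) one_ne_zero
  have h1 := eval_quadric_pderiv_one hn hq a b 1
  have h0 := eval_quadric_pderiv_zero hn hq a b 1
  have h := eval_ballicoHefezPoly_quadric q a b 1 1
  simp only [one_pow, mul_one, one_mul] at h0 h1 h
  rw [hx, hy, h]
  linear_combination (-(b - a ^ q)) * h1 -
    (eval ![(a + 1) * (b + 1), a * b, 1] (pderiv 0 (ballicoHefezPoly k q)) * (a + 1) +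
      eval ![(a + 1) * (b + 1), a * b, 1] (pderiv 1 (ballicoHefezPoly k q)) * a) * h0

variable [Fact p.Prime]

/-- A line through `[1 : 0 : 0]` is transverse to the Ballico–Hefez curve unless it is defined
over the field with `q` elements. -/
theorem frobenius_mul_eq_of_eval_pderiv_eq_zero (hn : 0 < n) (hq : q = p ^ n) (v : Fin 3 → k)
    (h : eval v (ballicoHefezPoly k q) = 0) (h' : eval v (pderiv 0 (ballicoHefezPoly k q)) = 0) :
    v 1 ^ q * v 2 = v 1 * v 2 ^ q := by
  have hq1 := one_lt_frobenius hn hq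
  by_cases hc : v 2 = 0
  · simp [hc, show q ≠ 0 by omega]
  obtain ⟨c, hcc⟩ := IsAlgClosed.exists_pow_nat_eq (v 2) (n := 2) (by norm_num)
  have hc0 : c ≠ 0 := by rintro rfl; simp at hcc; simp [← hcc] at hc
  obtain ⟨a, b, h0, h1⟩ := exists_quadric_eq (v 0) (v 1) c hc0
  have key : ∀ a b : k, v 0 = (a + c) * (b + c) → v 1 = a * b → b * c ^ q = a ^ q * c →
      v 1 ^ q * v 2 = v 1 * v 2 ^ q := by
    intro a b h0 h1 hab
    have hvec : v = ![(a + c) * (b + c), a * b, c * c] := by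
      ext i; fin_cases i <;> simp [h0, h1, ← hcc, pow_two]
    have e1 := eval_quadric_pderiv_one hn hq a b c
    have e0 := eval_quadric_pderiv_zero hn hq a b c
    rw [← hvec, h'] at e0 e1
    rw [show b * c ^ q - a ^ q * c = 0 by linear_combination hab] at e0
    have e0' : eval v (pderiv 1 (ballicoHefezPoly k q)) = 0 ∨ b = 0 := by simpa using e0
    rcases e0' with e0' | rfl
    · rw [e0'] at e1
      have e2 : a * c ^ q - b ^ q * c = 0 := by simpa [hc0] using e1.symm
      rw [h1, ← hcc, mul_pow, ← pow_mul, pow_mul']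
      linear_combination (-b ^ q * c) * hab - (b * c ^ q) * e2
    · rw [h1]; simp [show q ≠ 0 by omega]
  have hvec : v = ![(a + c) * (b + c), a * b, c * c] := by
    ext i; fin_cases i <;> simp [h0, h1, ← hcc, pow_two]
  rw [hvec, eval_ballicoHefezPoly_quadric, mul_eq_zero] at h
  rcases h with h | h
  · exact key a b h0 h1 (by linear_combination h)
  · exact key b a (by rw [h0]; ring) (by rw [h1]; ring) (by linear_combination h)

end Closed

/-! ### Points and homogeneous polynomials -/

theorem eval_smul_of_isHomogeneous {σ R : Type*} [CommRing R] {F : MvPolynomial σ R} {m : ℕ}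
    (hF : F.IsHomogeneous m) (t : R) (v : σ → R) : eval (t • v) F = t ^ m * eval v F := by
  rw [eval_eq, eval_eq, Finset.mul_sum]
  refine Finset.sum_congr rfl fun s hs => ?_
  rw [hF.degree_eq_sum_deg_support hs]
  simp only [Pi.smul_apply, smul_eq_mul, mul_pow, Finset.prod_mul_distrib,
    Finset.prod_pow_eq_pow_sum]
  ring

section

variable {k : Type*} [Field k]

theorem eval_rep_mk_eq_zero_iff {F : MvPolynomial (Fin 3) k} {m : ℕ} (hF : F.IsHomogeneous m)
    (v : Fin 3 → k) (hv : v ≠ 0) :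
    eval (Projectivization.mk k v hv).rep F = 0 ↔ eval v F = 0 := by
  obtain ⟨a, ha⟩ := Projectivization.exists_smul_eq_mk_rep k v hv
  rw [← ha, Units.smul_def, eval_smul_of_isHomogeneous hF]
  simp

theorem mk_mem_locus_iff {F : MvPolynomial (Fin 3) k} {m : ℕ} (hF : F.IsHomogeneous m)
    (v : Fin 3 → k) (hv : v ≠ 0) : Projectivization.mk k v hv ∈ locus F ↔ eval v F = 0 :=
  eval_rep_mk_eq_zero_iff hF v hv

theorem powerMap_mk (d : ℕ) (v : Fin 3 → k) (hv : v ≠ 0) (hv' : (fun i => v i ^ d) ≠ 0) :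
    powerMap d (Projectivization.mk k v hv) = Projectivization.mk k (fun i => v i ^ d) hv' := rfl

theorem pow_ne_zero_vec (d : ℕ) {v : Fin 3 → k} (hv : v ≠ 0) : (fun i => v i ^ d) ≠ 0 := by
  obtain ⟨i, hi⟩ := Function.ne_iff.mp hv
  exact Function.ne_iff.mpr ⟨i, pow_ne_zero d hi⟩

theorem mem_idealOf_iff {Z : Set (Plane k)} {F : MvPolynomial (Fin 3) k} : F ∈ idealOf Z ↔
    ∀ (v : Fin 3 → k) (hv : v ≠ 0), Projectivization.mk k v hv ∈ Z → eval v F = 0 := by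
  simp only [idealOf, mem_vanishingIdeal_iff, Set.mem_ofPred_eq, forall_exists_index, aeval_eq_eval]

theorem zariskiClosure_locus (F : MvPolynomial (Fin 3) k) {m : ℕ} (hF : F.IsHomogeneous m) :
    zariskiClosure (locus F) = locus F := by
  ext P
  constructor
  · intro h
    exact h F (mem_idealOf_iff.mpr fun v hv => (mk_mem_locus_iff hF v hv).mp)
  · intro hP G hG
    exact mem_idealOf_iff.mp hG P.rep P.rep_nonzero (by rwa [P.mk_rep])

theorem expand_isHomogeneous {F : MvPolynomial (Fin 3) k} {m : ℕ} (hF : F.IsHomogeneous m)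
    (d : ℕ) : (expand d F).IsHomogeneous (d * m) :=
  hF.aeval _ fun i => isHomogeneous_X_pow i d

theorem expand_eq_aeval {σ : Type*} (d : ℕ) (F : MvPolynomial σ k) :
    expand d F = aeval (fun i => X i ^ d) F := rfl

theorem pderiv_expand {σ : Type*} [Fintype σ] {d : ℕ} (hd : (d : k) = 1) (i : σ)
    (F : MvPolynomial σ k) :
    pderiv i (expand d F) = X i ^ (d - 1) * expand d (pderiv i F) := by
  classical
  have hd' : (d : MvPolynomial σ k) = 1 := by rw [← map_natCast (C : k →+* _), hd, map_one]
  rw [expand_eq_aeval, derivation_aeval, Finset.sum_eq_single i]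
  · simp [Derivation.leibniz_pow, hd', expand_eq_aeval, mul_comm]
  · intro j _ hj
    simp [Derivation.leibniz_pow, pderiv_X_of_ne hj]
  · simp

end

/-! ### The defining polynomials of the Ballico–Hefez curve and its pullbacks -/

section

variable {k : Type*} [Field k] [IsAlgClosed k] {p n q : ℕ} [Fact p.Prime] [CharP k p]

theorem mk_mem_ballicoHefez_iff (hq : q = p ^ n) (v : Fin 3 → k) (hv : v ≠ 0) :
    Projectivization.mk k v hv ∈ ballicoHefez k q ↔ eval v (ballicoHefezPoly k q) = 0 := by
  have hlin : (∑ i, X i : MvPolynomial (Fin 3) k).IsHomogeneous 1 :=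
    IsHomogeneous.sum _ _ _ fun i _ => isHomogeneous_X k i
  rw [eval_ballicoHefezPoly_eq_zero_iff hq]
  constructor
  · rintro ⟨P, hP, h⟩
    induction P using Projectivization.ind with | h w hw =>
    rw [mk_mem_locus_iff hlin] at hP
    rw [powerMap_mk _ _ _ (pow_ne_zero_vec _ hw), Projectivization.mk_eq_mk_iff'] at h
    obtain ⟨a, ha⟩ := h
    have ha0 : a ≠ 0 := by
      rintro rfl
      rw [zero_smul] at ha
      exact pow_ne_zero_vec _ hw ha.symm
    obtain ⟨t, ht⟩ := IsAlgClosed.exists_pow_nat_eq a⁻¹ (n := q + 1) (by omega)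
    refine ⟨t • w, ?_, fun i => ?_⟩
    · simp [Fin.sum_univ_three] at hP
      simp only [Pi.smul_apply, smul_eq_mul]
      linear_combination t * hP
    · have := congrFun ha i
      simp only [Pi.smul_apply, smul_eq_mul] at this ⊢
      rw [mul_pow, ht, ← this]
      field_simp
  · rintro ⟨w, hw, h⟩
    have hw0 : w ≠ 0 := by
      rintro rfl
      exact hv (funext fun i => by simp [h i])
    refine ⟨Projectivization.mk k w hw0, ?_, ?_⟩
    · rw [mk_mem_locus_iff hlin]
      simpa [Fin.sum_univ_three] using hw
    · rw [powerMap_mk _ _ _ (pow_ne_zero_vec _ hw0)]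
      congr 1
      exact (funext h).symm

theorem preimage_ballicoHefez_eq_locus (hq : q = p ^ n) (m : ℕ) :
    powerMap m ⁻¹' ballicoHefez k q = locus (expand m (ballicoHefezPoly k q)) := by
  ext P
  induction P using Projectivization.ind with | h v hv =>
  rw [mk_mem_locus_iff (expand_isHomogeneous (ballicoHefezPoly_isHomogeneous k q) m), eval_expand,
    Set.mem_preimage, powerMap_mk _ _ _ (pow_ne_zero_vec _ hv), mk_mem_ballicoHefez_iff hq]
  rfl

open Polynomial in
theorem polynomial_dvd_of_separable_of_root {f g : k[X]} (hf : f.Separable)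
    (h : ∀ y, f.eval y = 0 → g.eval y = 0) : f ∣ g := by
  rcases eq_or_ne g 0 with rfl | hg
  · exact dvd_zero f
  refine (IsAlgClosed.splits f).dvd_of_roots_le_roots hf.ne_zero ?_
  rw [Multiset.le_iff_subset (nodup_roots hf)]
  intro y hy
  rw [mem_roots hf.ne_zero] at hy
  rw [mem_roots hg]
  exact h y hy

theorem eval_ballicoHefezPoly_zero (hq : q = p ^ n) (y z : k) :
    eval ![0, y, z] (ballicoHefezPoly k q) = -(y - z) ^ (q + 1) := by
  have hq0 : q ≠ 0 := by rw [hq]; exact pow_ne_zero _ (Fact.out : p.Prime).ne_zero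
  have h : ![y, z, 0] = ![(1 + 0) * (z + (y - z)), 1 * z, 0 * (y - z)] := by simp
  rw [eval_ballicoHefezPoly_cyclic hq, h, eval_ballicoHefezPoly_quadric]
  simp [hq0]
  ring

theorem map_finSuccEquiv (s : Fin 2 → k) (F : MvPolynomial (Fin 3) k) :
    Polynomial.map (eval s) (finSuccEquiv k 2 F) =
      aeval (Fin.cons Polynomial.X fun i => Polynomial.C (s i) : Fin 3 → Polynomial k) F := by
  refine Polynomial.funext fun y => ?_
  rw [← eval_eq_eval_mv_eval', ← Polynomial.coe_aeval_eq_eval, ← AlgHom.comp_apply, comp_aeval,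
    ← aeval_eq_eval]
  congr 2
  ext i
  refine Fin.cases ?_ (fun j => ?_) i <;> simp

theorem derivative_map_finSuccEquiv (s : Fin 2 → k) (F : MvPolynomial (Fin 3) k) :
    Polynomial.derivative (Polynomial.map (eval s) (finSuccEquiv k 2 F)) =
      Polynomial.map (eval s) (finSuccEquiv k 2 (pderiv 0 F)) := by
  rw [map_finSuccEquiv, map_finSuccEquiv]
  have := derivation_aeval (Polynomial.derivative' (R := k))
    (Fin.cons Polynomial.X fun i => Polynomial.C (s i) : Fin 3 → Polynomial k) F
  simpa [Fin.sum_univ_succ, -aeval_eq_bind₁] using this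

/-- Up to sign the equation is `V_(q+1)` minus a term free of `x₀`, and `T = x₀^m - x₁^m - x₂^m` is
monic in `x₀`. -/
theorem finSuccEquiv_expand_monic {k : Type*} [Field k] {q : ℕ} (hq : 1 < q) {m : ℕ} (hm : 0 < m) :
    (-finSuccEquiv k 2 (expand m (ballicoHefezPoly k q))).Monic := by
  have h : finSuccEquiv k 2 (expand m (ballicoHefezPoly k q)) =
      aeval (fun i => finSuccEquiv k 2 (X i ^ m)) (ballicoHefezPoly k q) := by
    rw [expand_eq_aeval, ← AlgEquiv.coe_toAlgHom, ← AlgHom.comp_apply, comp_aeval]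
  rw [h, aeval_ballicoHefezPoly]
  have e1 : finSuccEquiv k 2 (X 1) = Polynomial.C (X 0) := finSuccEquiv_X_succ (j := 0)
  have e2 : finSuccEquiv k 2 (X 2) = Polynomial.C (X 1) := finSuccEquiv_X_succ (j := 1)
  simp only [map_pow (finSuccEquiv k 2), finSuccEquiv_X_zero, e1, e2]
  simp only [← Polynomial.C_pow, ← Polynomial.C_mul, ← Polynomial.C_add, sub_sub]
  have hT : (Polynomial.X ^ m - Polynomial.C (X 0 ^ m + X 1 ^ m) :
    Polynomial (MvPolynomial (Fin 2) k)).Monic := Polynomial.monic_X_pow_sub_C _ hm.ne'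
  have hTd : (Polynomial.X ^ m - Polynomial.C (X 0 ^ m + X 1 ^ m) :
    Polynomial (MvPolynomial (Fin 2) k)).natDegree = m := Polynomial.natDegree_X_pow_sub_C
  obtain ⟨hV, hVd⟩ := lucasV_monic hT (by omega) (X 0 ^ m * X 1 ^ m) q
  rw [neg_sub]
  refine hV.sub_of_left (lt_of_le_of_lt Polynomial.degree_C_le ?_)
  rw [← Polynomial.natDegree_pos_iff_degree_pos, hVd, hTd]
  positivity

/-- The ideal of a pullback of the Ballico–Hefez curve is generated by its equation: the equation
is monic in the first variable, and separable over a generic value of the other two. -/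
theorem expand_ballicoHefezPoly_dvd (hn : 0 < n) (hq : q = p ^ n) {m : ℕ} (hm : (m : k) = 1)
    {G : MvPolynomial (Fin 3) k}
    (hG : ∀ v : Fin 3 → k, v ≠ 0 → eval v (expand m (ballicoHefezPoly k q)) = 0 → eval v G = 0) :
    expand m (ballicoHefezPoly k q) ∣ G := by
  have hm0 : 0 < m := Nat.pos_of_ne_zero (by rintro rfl; simp at hm)
  have hq1 := one_lt_frobenius hn hq
  set H := expand m (ballicoHefezPoly k q) with hH
  have hmon := finSuccEquiv_expand_monic (k := k) hq1 hm0
  rw [← hH] at hmon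
  suffices h : finSuccEquiv k 2 G %ₘ (-finSuccEquiv k 2 H) = 0 by
    rw [Polynomial.modByMonic_eq_zero_iff_dvd hmon, neg_dvd] at h
    obtain ⟨c, hc⟩ := h
    refine ⟨(finSuccEquiv k 2).symm c, (finSuccEquiv k 2).injective ?_⟩
    rw [hc, map_mul, AlgEquiv.apply_symm_apply]
  -- The values of `(x₁, x₂)` to avoid are those where `[x₁^m : x₂^m]` is defined over the field
  -- with `q` elements, or both vanish. Setting `x₂ = 1` shows that this condition is not
  -- identically satisfied, as `q > 1`.
  have hgen : (X 0 ^ (m * q) * X 1 ^ m - X 0 ^ m * X 1 ^ (m * q) : MvPolynomial (Fin 2) k) ≠ 0 := by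
    intro h
    have h' := congrArg (aeval ![(Polynomial.X : Polynomial k), 1]) h
    simp only [map_sub, map_mul, map_pow, aeval_X, Matrix.cons_val_zero, Matrix.cons_val_one,
      one_pow, mul_one, map_zero, sub_eq_zero] at h'
    have h'' := congrArg Polynomial.natDegree h'
    rw [Polynomial.natDegree_X_pow, Polynomial.natDegree_X_pow] at h''
    have := Nat.eq_of_mul_eq_mul_left hm0 (h''.trans (mul_one m).symm)
    omega
  ext1 i
  rw [Polynomial.coeff_zero]
  -- Each coefficient of the remainder, times the polynomial of bad values, vanishes at every point:
  -- at good values the specialized equation is separable and all its roots are roots of `G`.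
  refine (mul_eq_zero.mp (MvPolynomial.funext fun s => ?_)).resolve_right hgen
  rw [map_mul, map_zero, ← Polynomial.coeff_map, mul_eq_zero, or_iff_not_imp_right]
  intro hs
  rw [Polynomial.map_modByMonic _ hmon, (Polynomial.modByMonic_eq_zero_iff_dvd (hmon.map _)).mpr,
    Polynomial.coeff_zero]
  rw [Polynomial.map_neg, neg_dvd]
  have hs' : (s 0 ^ m) ^ q * s 1 ^ m ≠ s 0 ^ m * (s 1 ^ m) ^ q := by
    simpa [← pow_mul, sub_eq_zero] using hs
  refine polynomial_dvd_of_separable_of_root ?_ fun y hy => ?_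
  -- A multiple root `y` has either `y = 0`, where the equation is `-(s₀^m - s₁^m)^(q+1)`, or a zero
  -- of `∂h/∂x₀`; both force a bad value of `s`.
  · rw [Polynomial.Separable, Polynomial.isCoprime_iff_aeval_ne_zero_of_isAlgClosed (k := k) k]
    intro y
    rw [derivative_map_finSuccEquiv, Polynomial.coe_aeval_eq_eval, ← eval_eq_eval_mv_eval',
      ← eval_eq_eval_mv_eval', pderiv_expand hm, map_mul, eval_expand, eval_expand, ← not_and_or]
    rintro ⟨h1, h2⟩
    apply hs'
    rw [mul_eq_zero] at h2
    rcases h2 with h2 | h2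
    · have hy : y = 0 := by
        simp only [map_pow, eval_X, Fin.cons_zero] at h2
        exact eq_zero_of_pow_eq_zero h2
      have hvec : (Fin.cons y s : Fin 3 → k) ^ m = ![0, s 0 ^ m, s 1 ^ m] := by
        ext i
        fin_cases i
        · simp [hy, hm0.ne']
        · rfl
        · rfl
      rw [hvec, eval_ballicoHefezPoly_zero hq, neg_eq_zero] at h1
      rw [sub_eq_zero.mp (eq_zero_of_pow_eq_zero h1), mul_comm]
    · exact frobenius_mul_eq_of_eval_pderiv_eq_zero hn hq _ h1 h2
  · rw [← eval_eq_eval_mv_eval'] at hy ⊢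
    refine hG _ ?_ hy
    intro h0
    apply hs'
    have : s 0 = 0 := congrFun h0 1
    have : s 1 = 0 := congrFun h0 2
    simp [*, zero_pow hm0.ne']

theorem isDefiningPolynomial_expand (hn : 0 < n) (hq : q = p ^ n) {m : ℕ} (hm : (m : k) = 1) :
    IsDefiningPolynomial (expand m (ballicoHefezPoly k q)) (powerMap m ⁻¹' ballicoHefez k q) := by
  have hm0 : 0 < m := Nat.pos_of_ne_zero (by rintro rfl; simp at hm)
  refine ⟨?_, ⟨_, expand_isHomogeneous (ballicoHefezPoly_isHomogeneous k q) m⟩,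
    (preimage_ballicoHefez_eq_locus hq m).symm, ?_⟩
  · intro h
    have := finSuccEquiv_expand_monic (k := k) (one_lt_frobenius hn hq) hm0
    rw [h, map_zero, neg_zero] at this
    exact this.ne_zero rfl
  · rw [preimage_ballicoHefez_eq_locus hq m]
    refine le_antisymm ?_ fun G hG => ?_
    · rw [Ideal.span_singleton_le_iff_mem, mem_idealOf_iff]
      exact fun v hv => (mk_mem_locus_iff
        (expand_isHomogeneous (ballicoHefezPoly_isHomogeneous k q) m) v hv).mp
    · rw [Ideal.mem_span_singleton]
      refine expand_ballicoHefezPoly_dvd hn hq hm fun v hv h => ?_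
      exact mem_idealOf_iff.mp hG v hv ((mk_mem_locus_iff
        (expand_isHomogeneous (ballicoHefezPoly_isHomogeneous k q) m) v hv).mpr h)

end

/-! ### The dual of the Fermat curve -/

section

variable {k : Type*} [Field k]

theorem fermat_isHomogeneous (d : ℕ) : (fermat k d).IsHomogeneous d :=
  IsHomogeneous.sum _ _ _ fun i _ => isHomogeneous_X_pow i d

theorem gradient_fermat {d : ℕ} (hd : (d : k) = 1) (v : Fin 3 → k) :
    gradient (fermat k d) v = fun i => v i ^ (d - 1) := by
  funext i
  have hd' : (d : MvPolynomial (Fin 3) k) = 1 := by rw [← map_natCast (C : k →+* _), hd, map_one]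
  rw [gradient, fermat, map_sum, map_sum, Finset.sum_eq_single i]
  · simp [hd']
  · intro j _ hj
    simp [Derivation.leibniz_pow, pderiv_X_of_ne hj]
  · simp

variable [IsAlgClosed k] {p n q d : ℕ} [Fact p.Prime] [CharP k p]

/-- The Gauss map is a bijection from the Fermat curve of degree `q ^ 2 + q + 1` onto the preimage
of the Ballico–Hefez curve; here its image is computed. -/
theorem gaussImage_fermat (hn : 0 < n) (hq : q = p ^ n) (hd : d = q ^ 2 + q + 1)
    (hd1 : (d : k) = 1) :
    {Q | ∃ P ∈ locus (fermat k d), ∃ h : gradient (fermat k d) P.rep ≠ 0,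
      Q = Projectivization.mk k (gradient (fermat k d) P.rep) h} =
      powerMap d ⁻¹' ballicoHefez k q := by
  have hq1 := one_lt_frobenius hn hq
  have hd' : d - 1 = q * (q + 1) := by rw [hd, Nat.add_sub_cancel]; ring
  ext Q
  constructor
  · rintro ⟨P, hP, h, rfl⟩
    rw [Set.mem_preimage, powerMap_mk _ _ _ (pow_ne_zero_vec _ h), mk_mem_ballicoHefez_iff hq,
      eval_ballicoHefezPoly_eq_zero_iff hq]
    -- Indeed `(x^(q(q+1)))^d = ((x^d)^q)^(q+1)`, and raising to the power `q` preserves the Fermat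
    -- relation.
    refine ⟨fun i => (P.rep i ^ d) ^ q, ?_, fun i => ?_⟩
    · have : P.rep 0 ^ d + P.rep 1 ^ d + P.rep 2 ^ d = 0 := by
        simpa [locus, fermat, Fin.sum_univ_three] using hP
      rw [← add_pow_frobenius hq, ← add_pow_frobenius hq, this, zero_pow (by omega)]
    · rw [gradient_fermat hd1, hd']
      ring
  · induction Q using Projectivization.ind with | h y hy =>
    rw [Set.mem_preimage, powerMap_mk _ _ _ (pow_ne_zero_vec _ hy), mk_mem_ballicoHefez_iff hq,
      eval_ballicoHefezPoly_eq_zero_iff hq]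
    rintro ⟨w, hw, hyw⟩
    choose z hz using fun i => IsAlgClosed.exists_pow_nat_eq (w i) (n := q) (by omega)
    have hzs : z 0 + z 1 + z 2 = 0 := by
      refine eq_zero_of_pow_eq_zero (n := q) ?_
      rw [add_pow_frobenius hq, add_pow_frobenius hq, hz, hz, hz, hw]
    have hyz : ∀ i, y i ^ d = z i ^ (d - 1) := fun i => by
      rw [hyw, ← hz, hd', pow_mul]
    have hd0 : d - 1 ≠ 0 := by rw [hd']; positivity
    have hsucc : d = d - 1 + 1 := by omega
    -- The preimage under the Gauss map is `x = z/y`: from `y^d = z^(d-1)` follow `x^d = z` and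
    -- `x^(d-1) = y`. When `y_i = 0` also `z_i = 0`, and the convention `0/0 = 0` gives the right
    -- value.
    have hx : ∀ i, (z i / y i) ^ d = z i := by
      intro i
      by_cases hyi : y i = 0
      · have : z i ^ (d - 1) = 0 := by rw [← hyz, hyi, zero_pow (by omega)]
        rw [hyi, eq_zero_of_pow_eq_zero this]
        simp [show d ≠ 0 by omega]
      · have : z i ^ (d - 1) ≠ 0 := by rw [← hyz]; exact pow_ne_zero _ hyi
        rw [div_pow, hyz, div_eq_iff this, mul_comm, ← pow_succ, ← hsucc]
    have hx' : ∀ i, (z i / y i) ^ (d - 1) = y i := by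
      intro i
      by_cases hyi : y i = 0
      · rw [hyi]; simp [hd0]
      · rw [div_pow, ← hyz, div_eq_iff (pow_ne_zero _ hyi), ← pow_succ', ← hsucc]
    have hx0 : (fun i => z i / y i) ≠ 0 := by
      intro h
      refine hy (funext fun i => ?_)
      rw [← hx' i, show z i / y i = 0 from congrFun h i, zero_pow hd0]; rfl
    obtain ⟨a, ha⟩ := Projectivization.exists_smul_eq_mk_rep k _ hx0
    have hgrad : gradient (fermat k d) (Projectivization.mk k _ hx0).rep =
        (a : k) ^ (d - 1) • y := by
      rw [gradient_fermat hd1, ← ha]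
      funext i
      simp only [Units.smul_def, Pi.smul_apply, smul_eq_mul, mul_pow, hx']
    refine ⟨Projectivization.mk k _ hx0, ?_, ?_, ?_⟩
    · rw [mk_mem_locus_iff (fermat_isHomogeneous d)]
      simp only [fermat, map_sum, map_pow, eval_X, hx]
      rw [Fin.sum_univ_three, hzs]
    · rw [hgrad]
      exact smul_ne_zero (pow_ne_zero _ a.ne_zero) hy
    · rw [Projectivization.mk_eq_mk_iff']
      refine ⟨((a : k) ^ (d - 1))⁻¹, ?_⟩
      rw [hgrad, inv_smul_smul₀ (pow_ne_zero _ a.ne_zero)]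

theorem dualCurve_fermat (hn : 0 < n) (hq : q = p ^ n) (hd : d = q ^ 2 + q + 1)
    (hd1 : (d : k) = 1) :
    dualCurve (fermat k d) = powerMap d ⁻¹' ballicoHefez k q := by
  rw [dualCurve, gaussImage_fermat hn hq hd hd1, preimage_ballicoHefez_eq_locus hq,
    zariskiClosure_locus _ (expand_isHomogeneous (ballicoHefezPoly_isHomogeneous k q) d)]

theorem isDefiningPolynomial_ballicoHefezPoly (hn : 0 < n) (hq : q = p ^ n) :
    IsDefiningPolynomial (ballicoHefezPoly k q) (ballicoHefez k q) := by
  have h := isDefiningPolynomial_expand (k := k) hn hq (m := 1) Nat.cast_one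
  have h1 : powerMap 1 ⁻¹' ballicoHefez k q = ballicoHefez k q := by
    ext P
    induction P using Projectivization.ind with | h v hv =>
    rw [Set.mem_preimage, powerMap_mk _ _ _ (pow_ne_zero_vec _ hv)]
    simp only [pow_one]
  rwa [expand_one_apply, h1] at h

end

/-! ### The equation near the coordinate axes -/

/-- This is the expansion of `V_(m+2)` to first order in `e`. For `m + 2 = q + 1` the coefficient of
the linear term becomes `1` in characteristic `p`, which makes the cofactor `R` in
`exists_axis_form` nonzero at the contact point. -/
theorem exists_lucasV_eq {R : Type*} [CommRing R] (T e : R) : ∀ m : ℕ, ∃ S : R,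
    lucasV T e (m + 2) = T ^ (m + 2) - (m + 2 : ℕ) * e * T ^ m + e ^ 2 * S
  | 0 => ⟨0, by simp [lucasV]; ring⟩
  | 1 => ⟨0, by simp [lucasV]; ring⟩
  | m + 2 => by
    obtain ⟨S₁, h₁⟩ := exists_lucasV_eq T e (m + 1)
    obtain ⟨S₀, h₀⟩ := exists_lucasV_eq T e m
    refine ⟨T * S₁ + (m + 2 : ℕ) * T ^ m - e * S₀, ?_⟩
    rw [lucasV, h₁, h₀]
    push_cast
    ring

section

variable {k : Type*} [Field k] [IsAlgClosed k] {p n q : ℕ} [Fact p.Prime] [CharP k p]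

theorem rename_ballicoHefezPoly (hq : q = p ^ n) :
    rename (· + 1) (ballicoHefezPoly k q) = ballicoHefezPoly k q := by
  refine MvPolynomial.funext fun v => ?_
  have h1 : v = ![v 0, v 1, v 2] := by ext i; fin_cases i <;> rfl
  have h2 : v ∘ (· + 1) = ![v 1, v 2, v 0] := by ext i; fin_cases i <;> rfl
  rw [eval_rename, h2, ← eval_ballicoHefezPoly_cyclic hq, ← h1]

/-- Near the point where a coordinate axis touches it, the Ballico–Hefez curve is smooth, and the
axis is tangent to it to order `q + 1`. -/
theorem exists_axis_form (hn : 0 < n) (hq : q = p ^ n) (j : Fin 3) :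
    ∃ R : MvPolynomial (Fin 3) k,
      ballicoHefezPoly k q = -(X (j + 1) - X (j + 2)) ^ (q + 1) + X j * R ∧
        eval (fun i => if i = j then 0 else 1) R = 1 := by
  have hq1 := one_lt_frobenius hn hq
  have h2 : ∃ R : MvPolynomial (Fin 3) k,
      ballicoHefezPoly k q = -(X (2 + 1) - X (2 + 2)) ^ (q + 1) + X 2 * R ∧
        eval (fun i => if i = 2 then 0 else 1) R = 1 := by
    -- The exponent `q - 1` appears in `R`. That it is nonzero matters at the end: the power
    -- `T^(q-1)` vanishes at `[1 : 1 : 0]`, where `T = 0`.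
    obtain ⟨m, rfl⟩ : ∃ m, q = m + 1 := ⟨q - 1, by omega⟩
    obtain ⟨S, hS⟩ := exists_lucasV_eq (X 0 - X 1 - X 2 : MvPolynomial (Fin 3) k) (X 1 * X 2) m
    have hq' : ((m + 2 : ℕ) : MvPolynomial (Fin 3) k) = 1 := by
      rw [← map_natCast (C : k →+* _), show m + 2 = m + 1 + 1 by ring, Nat.cast_succ (m + 1),
        natCast_frobenius_eq_zero hn hq, zero_add, map_one]
    have hT : (X 0 - X 1 - X 2 : MvPolynomial (Fin 3) k) ^ (m + 2) =
        (X 0 - X 1 - X 2) * ((X 0 - X 1) ^ (m + 1) - X 2 ^ (m + 1)) := by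
      rw [show m + 2 = m + 1 + 1 by ring, pow_succ', hq, sub_pow_char_pow]
    refine ⟨X 1 * X 2 ^ m + X 1 ^ (m + 1) + (X 0 - X 1) ^ (m + 1) + X 2 ^ m * (X 0 - X 1 - X 2) +
      X 1 * (X 0 - X 1 - X 2) ^ m - X 1 ^ 2 * X 2 * S, ?_, ?_⟩
    · rw [ballicoHefezPoly, show m + 1 + 1 = m + 2 by ring, hS, hT, hq']
      simp only [show (2 + 1 : Fin 3) = 0 from rfl, show (2 + 2 : Fin 3) = 1 from rfl]
      ring
    · have hm : m ≠ 0 := by omega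
      simp [hm]
  have step : ∀ j : Fin 3, (∃ R : MvPolynomial (Fin 3) k,
      ballicoHefezPoly k q = -(X (j + 1) - X (j + 2)) ^ (q + 1) + X j * R ∧
        eval (fun i => if i = j then 0 else 1) R = 1) → ∃ R : MvPolynomial (Fin 3) k,
      ballicoHefezPoly k q = -(X (j + 1 + 1) - X (j + 1 + 2)) ^ (q + 1) + X (j + 1) * R ∧
        eval (fun i => if i = j + 1 then 0 else 1) R = 1 := by
    rintro j ⟨R, hR, hR1⟩
    refine ⟨rename (· + 1) R, ?_, ?_⟩
    · have := congrArg (rename (· + 1)) hR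
      rw [rename_ballicoHefezPoly hq] at this
      rw [this]
      simp only [map_add, map_neg, map_pow, map_sub, map_mul, rename_X]
      rw [add_right_comm j 2 1]
    · rw [eval_rename]
      exact Eq.trans (congrArg (fun v => eval v R) (funext fun i => by simp)) hR1
  fin_cases j
  · exact step 2 h2
  · exact step 0 (step 2 h2)
  · exact h2

/-- The two other coordinates may be taken in either order, because `(-1)^(q+1) = 1` in
characteristic `p`, including `p = 2`. -/
theorem exists_axis_form_of_ne (hn : 0 < n) (hq : q = p ^ n) {i j l : Fin 3} (hij : i ≠ j)
    (hlj : l ≠ j) (hil : i ≠ l) :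
    ∃ R : MvPolynomial (Fin 3) k, ballicoHefezPoly k q = -(X l - X i) ^ (q + 1) + X j * R ∧
        eval (fun i => if i = j then 0 else 1) R = 1 := by
  obtain ⟨R, hR, hR1⟩ := exists_axis_form (k := k) hn hq j
  refine ⟨R, ?_, hR1⟩
  have h : (l = j + 1 ∧ i = j + 2) ∨ (l = j + 2 ∧ i = j + 1) := by
    clear hR hR1 R; revert i j l; decide
  rcases h with ⟨rfl, rfl⟩ | ⟨rfl, rfl⟩
  · exact hR
  · rw [hR]
    congr 2
    rw [pow_succ, pow_succ, hq, sub_pow_char_pow, sub_pow_char_pow]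
    ring

end

/-! ### Power series in two variables -/

section

variable {k : Type*} [Field k]

theorem finsupp_eq_single_add_single {s t : Fin 2} (hst : s ≠ t) (m : Fin 2 →₀ ℕ) :
    m = Finsupp.single s (m s) + Finsupp.single t (m t) := by
  ext i
  have : i = s ∨ i = t := by revert s t i; decide
  rcases this with rfl | rfl
  · simp [hst]
  · simp [hst.symm]

theorem mem_span_X_pow_pair_iff {s t : Fin 2} (hst : s ≠ t) (a b : ℕ)
    (f : MvPowerSeries (Fin 2) k) :
    f ∈ (Ideal.span {MvPowerSeries.X s ^ a, MvPowerSeries.X t ^ b} :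
      Ideal (MvPowerSeries (Fin 2) k)) ↔
      ∀ i < a, ∀ j < b,
        MvPowerSeries.coeff (Finsupp.single s i + Finsupp.single t j) f = 0 := by
  constructor
  · intro hf i hi j hj
    obtain ⟨u, v, rfl⟩ := Ideal.mem_span_pair.mp hf
    rw [map_add, MvPowerSeries.X_pow_dvd_iff.mp (dvd_mul_left _ u) _ (by simpa [hst.symm] using hi),
      MvPowerSeries.X_pow_dvd_iff.mp (dvd_mul_left _ v) _ (by simpa [hst] using hj), add_zero]
  · intro hf
    -- The terms of exponent at least `a` in `X s` are split off; the remaining ones have exponent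
    -- at least `b` in `X t` by hypothesis.
    let g : MvPowerSeries (Fin 2) k := fun m => if m s < a then 0 else MvPowerSeries.coeff m f
    have hg : ∀ m, MvPowerSeries.coeff m g = if m s < a then 0 else MvPowerSeries.coeff m f :=
      fun _ => rfl
    have h1 : MvPowerSeries.X s ^ a ∣ g :=
      MvPowerSeries.X_pow_dvd_iff.mpr fun m hm => by rw [hg, if_pos hm]
    have h2 : MvPowerSeries.X t ^ b ∣ f - g := by
      refine MvPowerSeries.X_pow_dvd_iff.mpr fun m hm => ?_
      rw [map_sub, hg]
      split_ifs with h
      · have := hf _ h _ hm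
        rw [← finsupp_eq_single_add_single hst m] at this
        rw [this, sub_zero]
      · rw [sub_self]
    obtain ⟨u, hu⟩ := h1
    obtain ⟨v, hv⟩ := h2
    rw [Ideal.mem_span_pair]
    exact ⟨u, v, by linear_combination -hu - hv⟩

theorem toENat_rank_quotient_X_pow_pair {s t : Fin 2} (hst : s ≠ t) (a b : ℕ) :
    Cardinal.toENat (Module.rank k (MvPowerSeries (Fin 2) k ⧸
      (Ideal.span {MvPowerSeries.X s ^ a, MvPowerSeries.X t ^ b} :
        Ideal (MvPowerSeries (Fin 2) k)))) = ((a * b : ℕ) : ℕ∞) := by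
  set I := (Ideal.span {MvPowerSeries.X s ^ a, MvPowerSeries.X t ^ b} :
        Ideal (MvPowerSeries (Fin 2) k)) with hI
  let L : MvPowerSeries (Fin 2) k →ₗ[k] (Fin a × Fin b → k) :=
    LinearMap.pi fun ij => MvPowerSeries.coeff (Finsupp.single s ij.1.1 + Finsupp.single t ij.2.1)
  have hL : Function.Surjective L := by
    intro g
    refine ⟨fun m => if h : m s < a ∧ m t < b then g (⟨m s, h.1⟩, ⟨m t, h.2⟩) else 0, ?_⟩
    funext ⟨i, j⟩
    have e1 : (Finsupp.single s i.1 + Finsupp.single t j.1 : Fin 2 →₀ ℕ) s = i := by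
      simp [hst.symm]
    have e2 : (Finsupp.single s i.1 + Finsupp.single t j.1 : Fin 2 →₀ ℕ) t = j := by
      simp [hst]
    refine (dif_pos ⟨e1.trans_lt i.2, e2.trans_lt j.2⟩).trans ?_
    congr 2 <;> exact Fin.ext ‹_›
  have hker : LinearMap.ker L = I.restrictScalars k := by
    ext f
    rw [Submodule.restrictScalars_mem, hI, mem_span_X_pow_pair_iff hst, LinearMap.mem_ker]
    constructor
    · intro h i hi j hj
      exact congrFun h (⟨i, hi⟩, ⟨j, hj⟩)
    · intro h
      funext ⟨i, j⟩
      exact h i i.2 j j.2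
  have e : (MvPowerSeries (Fin 2) k ⧸ I) ≃ₗ[k] (Fin a × Fin b → k) :=
    (Submodule.Quotient.restrictScalarsEquiv k I).symm.trans
      ((Submodule.quotEquivOfEq _ _ hker.symm).trans (L.quotKerEquivOfSurjective hL))
  have := e.lift_rank_eq
  rw [← Cardinal.toENat_lift, this, Cardinal.toENat_lift]
  simp

theorem span_pair_eq_of_isUnit_det {A : Type*} [CommRing A] (x y a b c d : A)
    (h : IsUnit (a * d - b * c)) :
    Ideal.span {x * a + y * b, x * c + y * d} = Ideal.span {x, y} := by
  obtain ⟨u, hu⟩ := h.exists_right_inv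
  apply le_antisymm <;> rw [Ideal.span_le, Set.insert_subset_iff, Set.singleton_subset_iff]
  · exact ⟨Ideal.mem_span_pair.mpr ⟨a, b, by ring⟩, Ideal.mem_span_pair.mpr ⟨c, d, by ring⟩⟩
  · exact ⟨Ideal.mem_span_pair.mpr ⟨u * d, -(u * b), by linear_combination x * hu⟩,
      Ideal.mem_span_pair.mpr ⟨-(u * c), u * a, by linear_combination y * hu⟩⟩

/-- A series `-(y ω) ^ (q + 1) + x ^ (m + 1) r`, with `ω` and `r` invertible, has Milnor number
`m * q`, and so has every multiple of it by a unit, if `q = m = 0` in `k`, the derivative of `y ω`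
in `x` vanishes, and that in `y` is invertible. -/
theorem milnorNumber_mul_unit {s t : Fin 2} (hst : s ≠ t) {q m : ℕ} (hq : (q : k) = 0)
    (hm : (m : k) = 0) {ω r v u : MvPowerSeries (Fin 2) k}
    (hω : MvPowerSeries.constantCoeff ω ≠ 0) (hr : MvPowerSeries.constantCoeff r ≠ 0)
    (hv : MvPowerSeries.constantCoeff v ≠ 0)
    (hs : MvPowerSeries.pderiv k s (MvPowerSeries.X t * ω) = 0)
    (ht : MvPowerSeries.pderiv k t (MvPowerSeries.X t * ω) = v)
    (hu : MvPowerSeries.constantCoeff u ≠ 0) :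
    milnorNumber (u *
      (-(MvPowerSeries.X t * ω) ^ (q + 1) + MvPowerSeries.X s ^ (m + 1) * r)) =
        ((m * q : ℕ) : ℕ∞) := by
  have hq' : (q : MvPowerSeries (Fin 2) k) = 0 := by
    rw [← map_natCast (MvPowerSeries.C (σ := Fin 2)), hq, map_zero]
  have hm' : (m : MvPowerSeries (Fin 2) k) = 0 := by
    rw [← map_natCast (MvPowerSeries.C (σ := Fin 2)), hm, map_zero]
  set f := u *
      (-(MvPowerSeries.X t * ω) ^ (q + 1) + MvPowerSeries.X s ^ (m + 1) * r) with hf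
  -- The terms containing a derivative of `u` are multiples of the series itself, which lies in the
  -- maximal ideal times `(X s ^ m, X t ^ q)`. They therefore do not affect the coefficient matrix
  -- at the origin.
  have hs' : MvPowerSeries.pderiv k s f = MvPowerSeries.X s ^ m *
        (u * (r + MvPowerSeries.X s * MvPowerSeries.pderiv k s r) +
          MvPowerSeries.X s * r * MvPowerSeries.pderiv k s u) +
      MvPowerSeries.X t ^ q * (-(MvPowerSeries.X t * ω ^ (q + 1)) *
          MvPowerSeries.pderiv k s u) := by
    rw [hf]
    simp only [Derivation.leibniz, smul_eq_mul, map_add, map_neg, Derivation.leibniz_pow, hs,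
      smul_zero, neg_zero, zero_add, MvPowerSeries.pderiv_X_self, Nat.add_sub_cancel, nsmul_eq_mul,
      Nat.cast_add, Nat.cast_one, hm', mul_zero]
    ring
  have ht' : MvPowerSeries.pderiv k t f = MvPowerSeries.X s ^ m *
        (u * (MvPowerSeries.X s * MvPowerSeries.pderiv k t r) +
          MvPowerSeries.X s * r * MvPowerSeries.pderiv k t u) +
      MvPowerSeries.X t ^ q * (-(u * ω ^ q * v) - MvPowerSeries.X t * ω ^ (q + 1) *
          MvPowerSeries.pderiv k t u) := by
    rw [hf, Derivation.leibniz, map_add, map_neg, Derivation.leibniz_pow, ht, Derivation.leibniz,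
      Derivation.leibniz_pow, MvPowerSeries.pderiv_X_of_ne hst]
    simp only [smul_eq_mul, nsmul_eq_mul, Nat.add_sub_cancel, Nat.cast_add, Nat.cast_one, hq']
    ring
  have hspan : (Ideal.span {MvPowerSeries.pderiv k s f, MvPowerSeries.pderiv k t f} :
      Ideal (MvPowerSeries (Fin 2) k)) =
      Ideal.span {MvPowerSeries.X s ^ m, MvPowerSeries.X t ^ q} := by
    rw [hs', ht']
    -- At the origin the matrix is diagonal with entries `u r` and `-u ω^q v`, both nonzero.
    apply span_pair_eq_of_isUnit_det
    rw [MvPowerSeries.isUnit_iff_constantCoeff, isUnit_iff_ne_zero]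
    simp [hω, hr, hv, hu]
  have hpair : (Ideal.span {MvPowerSeries.pderiv k 0 f, MvPowerSeries.pderiv k 1 f} :
      Ideal (MvPowerSeries (Fin 2) k)) =
      Ideal.span {MvPowerSeries.pderiv k s f, MvPowerSeries.pderiv k t f} := by
    have : (s = 0 ∧ t = 1) ∨ (s = 1 ∧ t = 0) := by clear * - hst; revert s t; decide
    rcases this with ⟨rfl, rfl⟩ | ⟨rfl, rfl⟩
    · rfl
    · rw [Set.pair_comm]
  rw [milnorNumber, hpair, hspan, toENat_rank_quotient_X_pow_pair hst]

end

theorem constantCoeff_coe {k : Type*} [Field k] (F : MvPolynomial (Fin 2) k) :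
    MvPowerSeries.constantCoeff (F : MvPowerSeries (Fin 2) k) = MvPolynomial.constantCoeff F := by
  rw [← MvPowerSeries.coeff_zero_eq_constantCoeff_apply, MvPolynomial.coeff_coe]
  rfl

/-! ### Local equations -/

section

variable {k : Type*} [Field k]

/-- The coordinates of the plane as functions on the chart around `[v]` in which `x_i = 1`. -/
def chartCoord (v : Fin 3 → k) (i : Fin 3) : Fin 3 → MvPolynomial (Fin 2) k :=
  Fin.insertNth (α := fun _ => MvPolynomial (Fin 2) k) i 1
    (fun j => X j + C (v (i.succAbove j) / v i))

theorem localPolynomial_eq (F : MvPolynomial (Fin 3) k) (v : Fin 3 → k) (i : Fin 3) :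
    localPolynomial F v i = aeval (chartCoord v i) F := rfl

theorem constantCoeff_aeval (g : Fin 3 → MvPolynomial (Fin 2) k) (F : MvPolynomial (Fin 3) k) :
    constantCoeff (aeval g F) = eval (fun i => constantCoeff (g i)) F := by
  rw [MvPolynomial.map_aeval]
  have : constantCoeff.comp (algebraMap k (MvPolynomial (Fin 2) k)) = RingHom.id k := by
    ext; simp
  rw [this]
  rfl

/-- Two defining polynomials generate the same ideal, so they differ by a unit, which stays a unit
in the power series ring. A statement about all local equations thus needs only one polynomial `H`.
-/
theorem isLocalEquation_iff {Z : Set (Plane k)} {P : Plane k} {H : MvPolynomial (Fin 3) k}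
    (hH : IsDefiningPolynomial H Z) (f : MvPowerSeries (Fin 2) k) : IsLocalEquation Z P f ↔
      ∃ i : Fin 3, P.rep i ≠ 0 ∧ ∃ u : (MvPowerSeries (Fin 2) k)ˣ,
        f = u * (localPolynomial H P.rep i : MvPowerSeries (Fin 2) k) := by
  constructor
  · rintro ⟨F, hF, i, hi, u, rfl⟩
    obtain ⟨w, hw⟩ := Ideal.span_singleton_eq_span_singleton.mp (hH.span_eq.trans hF.span_eq.symm)
    refine ⟨i, hi, u * Units.map ((coeToMvPowerSeries.ringHom (R := k)).comp
      (aeval (chartCoord P.rep i)).toRingHom).toMonoidHom w, ?_⟩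
    rw [← hw, localPolynomial_eq, localPolynomial_eq, map_mul, Units.val_mul, Units.coe_map,
      coe_mul]
    simp
    ring
  · rintro ⟨i, hi, u, rfl⟩
    exact ⟨H, hH, i, hi, u, rfl⟩

variable [IsAlgClosed k] {p n q d : ℕ} [Fact p.Prime] [CharP k p]

/-- In any chart containing the point, `X s` is the vanishing coordinate `x_j` and `X t` the other
one, recentred at `c` with `c^d = 1`. The axis form of `h` then gives the local equation required by
`milnorNumber_mul_unit`, with `m = d - 1 = q(q+1)`. -/
theorem hasMilnorNumber_axis (hn : 0 < n) (hq : q = p ^ n) (hd : d = q ^ 2 + q + 1)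
    {P : Plane k} (hP : P ∈ powerMap d ⁻¹' ballicoHefez k q) {j : Fin 3} (hj : P.rep j = 0) :
    HasMilnorNumber (powerMap d ⁻¹' ballicoHefez k q) P ((q ^ 2 * (q + 1) : ℕ) : ℕ∞) := by
  have hq0 : (q : k) = 0 := natCast_frobenius_eq_zero hn hq
  have hd1 : (d : k) = 1 := by rw [hd]; push_cast; rw [hq0]; ring
  have hH := isDefiningPolynomial_expand (k := k) hn hq hd1
  constructor
  · obtain ⟨i, hi⟩ := Function.ne_iff.mp P.rep_nonzero
    exact ⟨_, (isLocalEquation_iff hH _).mpr ⟨i, hi, 1, rfl⟩⟩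
  intro f hf
  obtain ⟨i, hi, u, rfl⟩ := (isLocalEquation_iff hH f).mp hf
  have hij : i ≠ j := by rintro rfl; exact hi hj
  obtain ⟨s, hs⟩ := Fin.exists_succAbove_eq hij.symm
  obtain ⟨t, hst⟩ : ∃ t, s ≠ t := ⟨s + 1, by clear hs; revert s; decide⟩
  set l := i.succAbove t with hl
  have hlj : l ≠ j := by rw [← hs, hl]; exact fun h => hst (Fin.succAbove_right_injective h).symm
  have hil : i ≠ l := (Fin.succAbove_ne i t).symm
  set c := P.rep l / P.rep i with hc
  obtain ⟨R, hR, hR1⟩ := exists_axis_form_of_ne (k := k) hn hq hij hlj hil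
  have hd0 : 0 < d := by omega
  have hcd : c ^ d = 1 := by
    rw [preimage_ballicoHefez_eq_locus hq] at hP
    have : eval P.rep (expand d (ballicoHefezPoly k q)) = 0 := hP
    rw [eval_expand, hR] at this
    simp [hj, hd0.ne', sub_eq_zero] at this
    rw [hc, div_pow, this, div_self (pow_ne_zero _ hi)]
  have hc0 : c ≠ 0 := by rintro h; rw [h, zero_pow hd0.ne'] at hcd; exact zero_ne_one hcd
  -- The quotient of `(X t + c)^d - c^d` by `X t`, as a geometric sum. Its value at the origin is `d
  -- c^(d-1) = c^(d-1)`, which is nonzero.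
  set ω : MvPolynomial (Fin 2) k :=
    ∑ e ∈ Finset.range d, (X t + C c) ^ e * C c ^ (d - 1 - e) with hω
  have hω' : X t * ω = (X t + C c) ^ d - 1 := by
    have := mul_comm ω _ ▸ (Commute.all (X t + C c) (C c)).geom_sum₂_mul d
    rw [add_sub_cancel_right, ← C_pow, hcd, C_1] at this
    rw [← this, hω]
  have hci : chartCoord P.rep i i = 1 := by simp [chartCoord]
  have hcj : chartCoord P.rep i j = X s := by
    have : chartCoord P.rep i (i.succAbove s) = X s + C (P.rep (i.succAbove s) / P.rep i) := by
      simp [chartCoord]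
    rw [← hs, this, hs, hj]
    simp
  have hcl : chartCoord P.rep i l = X t + C c := by rw [hl]; simp [chartCoord, hc, hl]
  obtain ⟨r, hr⟩ : ∃ r, r = aeval (fun i' => chartCoord P.rep i i' ^ d) R := ⟨_, rfl⟩
  have hd' : d = q * (q + 1) + 1 := by rw [hd]; ring
  have hloc : localPolynomial (expand d (ballicoHefezPoly k q)) P.rep i =
      -(X t * ω) ^ (q + 1) + X s ^ (q * (q + 1) + 1) * r := by
    rw [localPolynomial_eq, aeval_expand, hR]
    simp only [map_add, map_neg, map_pow, map_sub, map_mul, aeval_X]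
    rw [show chartCoord P.rep i ^ d = fun i' => chartCoord P.rep i i' ^ d from rfl, ← hr]
    simp only [hci, hcj, hcl, one_pow]
    rw [hω', ← hd']
  -- The power map sends the point to the contact point of the axis with `B`, where `R` takes the
  -- value `1`.
  have hr1 : constantCoeff r = 1 := by
    have hv : (fun i' => constantCoeff (chartCoord P.rep i i' ^ d)) =
        fun i' => if i' = j then 0 else 1 := by
      funext i'
      have : i' = i ∨ i' = j ∨ i' = l := by omega
      rcases this with rfl | rfl | rfl
      · simp [hci, hij]
      · simp [hcj, hd0.ne']
      · simp [hcl, hlj, hcd]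
    rw [hr, constantCoeff_aeval, hv, hR1]
  have hcoe : ((localPolynomial (expand d (ballicoHefezPoly k q)) P.rep i :
      MvPolynomial (Fin 2) k) : MvPowerSeries (Fin 2) k) =
      -(MvPowerSeries.X t * (ω : MvPowerSeries (Fin 2) k)) ^ (q + 1) +
        MvPowerSeries.X s ^ (q * (q + 1) + 1) * (r : MvPowerSeries (Fin 2) k) := by
    rw [hloc]
    rw [← coeToMvPowerSeries.ringHom_apply]
    simp only [map_add, map_neg, map_pow, map_mul, coeToMvPowerSeries.ringHom_apply, coe_X]
  have hcast : ((X t * ω : MvPolynomial (Fin 2) k) : MvPowerSeries (Fin 2) k) =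
      MvPowerSeries.X t * (ω : MvPowerSeries (Fin 2) k) := by
    rw [coe_mul, coe_X]
  have hdp : (d : MvPolynomial (Fin 2) k) = 1 := by rw [← map_natCast (C : k →+* _), hd1, map_one]
  rw [hcoe, milnorNumber_mul_unit hst hq0 (by push_cast; rw [hq0, zero_mul])
    (v := (((X t + C c) ^ (d - 1) : MvPolynomial (Fin 2) k) : MvPowerSeries (Fin 2) k))]
  · congr 1; ring
  · rw [constantCoeff_coe, hω]
    simp only [map_sum, map_mul, map_pow, map_add, constantCoeff_X, constantCoeff_C, zero_add]
    rw [geom_sum₂_self, hd1, one_mul]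
    exact pow_ne_zero _ hc0
  · rw [constantCoeff_coe, hr1]; exact one_ne_zero
  · rw [constantCoeff_coe]
    simp [hc0]
  · rw [← hcast, MvPowerSeries.pderiv_coe, hω']
    simp [Derivation.leibniz_pow, pderiv_X_of_ne hst.symm]
  · rw [← hcast, MvPowerSeries.pderiv_coe, hω']
    simp [Derivation.leibniz_pow, hdp]
  · exact (MvPowerSeries.isUnit_iff_constantCoeff.mp u.isUnit).ne_zero

end

/-! ### The nodes -/

section

variable {k : Type*} [Field k]

theorem sub_C_constantCoeff_mem (F : MvPolynomial (Fin 2) k) :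
    F - C (constantCoeff F) ∈ (Ideal.span {X 0, X 1} : Ideal (MvPolynomial (Fin 2) k)) := by
  have hX : ∀ i : Fin 2, (X i : MvPolynomial (Fin 2) k) ∈ Ideal.span {X 0, X 1} := fun i =>
    Ideal.subset_span (by fin_cases i <;> simp)
  induction F using MvPolynomial.induction_on with
  | C a => simp
  | add F G hF hG =>
    rw [map_add, C_add, add_sub_add_comm]
    exact add_mem hF hG
  | mul_X F i _ =>
    rw [map_mul, constantCoeff_X, mul_zero, C_0, sub_zero]
    exact Ideal.mul_mem_left _ _ (hX i)

/-- First order Taylor expansion at the origin. -/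
theorem sub_linear_mem (F : MvPolynomial (Fin 2) k) :
    F - (C (constantCoeff F) + C (constantCoeff (pderiv 0 F)) * X 0 +
      C (constantCoeff (pderiv 1 F)) * X 1) ∈
      (Ideal.span {X 0, X 1} : Ideal (MvPolynomial (Fin 2) k)) ^ 2 := by
  have hX : ∀ i : Fin 2, (X i : MvPolynomial (Fin 2) k) ∈ Ideal.span {X 0, X 1} := fun i =>
    Ideal.subset_span (by fin_cases i <;> simp)
  induction F using MvPolynomial.induction_on with
  | C a => simp
  | add F G hF hG =>
    convert add_mem hF hG using 1
    simp only [map_add]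
    ring
  | mul_X F i _ =>
    have h := Ideal.mul_mem_mul (sub_C_constantCoeff_mem F) (hX i)
    rw [← pow_two] at h
    convert h using 1
    fin_cases i <;> simp [Derivation.leibniz] <;> ring

/-- If `f` is a quadratic form in `p` and `r`, with coefficients that at the origin are those of a
product of linear forms, and `p`, `r` are local parameters, then `f` has a node at the origin. -/
theorem quadratic_sub_mul_mem {f p r u v : MvPolynomial (Fin 2) k} {a b p₀ p₁ r₀ r₁ : k}
    (hf : f = u * p ^ 2 + (u + v - 1) * p * r + v * r ^ 2)
    (hu : constantCoeff u = (a + 1) * (b + 1)) (hv : constantCoeff v = a * b)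
    (hp : constantCoeff p = 0) (hr : constantCoeff r = 0)
    (hp₀ : constantCoeff (pderiv 0 p) = p₀) (hp₁ : constantCoeff (pderiv 1 p) = p₁)
    (hr₀ : constantCoeff (pderiv 0 r) = r₀) (hr₁ : constantCoeff (pderiv 1 r) = r₁) :
    f - (C ((a + 1) * p₀ + a * r₀) * X 0 + C ((a + 1) * p₁ + a * r₁) * X 1) *
      (C ((b + 1) * p₀ + b * r₀) * X 0 + C ((b + 1) * p₁ + b * r₁) * X 1) ∈
      (Ideal.span {X 0, X 1} : Ideal (MvPolynomial (Fin 2) k)) ^ 3 := by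
  set m := (Ideal.span {X 0, X 1} : Ideal (MvPolynomial (Fin 2) k)) with hm
  have hX : ∀ i : Fin 2, (X i : MvPolynomial (Fin 2) k) ∈ m := fun i =>
    Ideal.subset_span (by fin_cases i <;> simp)
  have hpl := sub_linear_mem p
  have hrl := sub_linear_mem r
  rw [hp, hp₀, hp₁, C_0, zero_add, ← hm] at hpl
  rw [hr, hr₀, hr₁, C_0, zero_add, ← hm] at hrl
  have hpm := sub_C_constantCoeff_mem p
  have hrm := sub_C_constantCoeff_mem r
  have hum := sub_C_constantCoeff_mem u
  have hvm := sub_C_constantCoeff_mem v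
  rw [hp, C_0, sub_zero, ← hm] at hpm
  rw [hr, C_0, sub_zero, ← hm] at hrm
  rw [hu, ← hm] at hum
  rw [hv, ← hm] at hvm
  set lp : MvPolynomial (Fin 2) k := C p₀ * X 0 + C p₁ * X 1 with hlp
  set lr : MvPolynomial (Fin 2) k := C r₀ * X 0 + C r₁ * X 1 with hlr
  have hlpm : lp ∈ m := add_mem (m.mul_mem_left _ (hX 0)) (m.mul_mem_left _ (hX 1))
  have hlrm : lr ∈ m := add_mem (m.mul_mem_left _ (hX 0)) (m.mul_mem_left _ (hX 1))
  have h3 : ∀ {x y z : MvPolynomial (Fin 2) k}, x ∈ m → y ∈ m → z ∈ m →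
      x * (y * z) ∈ m ^ 3 := fun hx hy hz => by
    rw [show m ^ 3 = m * (m * m) by ring]
    exact Ideal.mul_mem_mul hx (Ideal.mul_mem_mul hy hz)
  have h21 : ∀ {x y : MvPolynomial (Fin 2) k}, x ∈ m ^ 2 → y ∈ m → x * y ∈ m ^ 3 := fun hx hy => by
    rw [show m ^ 3 = m ^ 2 * m by ring]
    exact Ideal.mul_mem_mul hx hy
  -- Replacing `u`, `v` by their constant terms costs an element of `m` times a product of two
  -- elements of `m`. The resulting form splits as `((a+1)p + ar)((b+1)p + br)`, and replacing `p`,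
  -- `r` by their linear parts costs elements of `m² m`.
  have key : f - (C ((a + 1) * p₀ + a * r₀) * X 0 + C ((a + 1) * p₁ + a * r₁) * X 1) *
      (C ((b + 1) * p₀ + b * r₀) * X 0 + C ((b + 1) * p₁ + b * r₁) * X 1) =
      (u - C ((a + 1) * (b + 1))) * (p * p) +
      ((u - C ((a + 1) * (b + 1))) + (v - C (a * b))) * (p * r) + (v - C (a * b)) * (r * r) +
      (C (a + 1) * (p - lp) + C a * (r - lr)) * (C (b + 1) * p + C b * r) +
      (C (b + 1) * (p - lp) + C b * (r - lr)) * (C (a + 1) * lp + C a * lr) := by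
    rw [hf, hlp, hlr]
    simp only [C_mul, C_add, C_1]
    ring
  rw [key]
  refine add_mem (add_mem (add_mem (add_mem (h3 hum hpm hpm) (h3 (add_mem hum hvm) hpm hrm))
    (h3 hvm hrm hrm)) (h21 ?_ ?_)) (h21 ?_ ?_)
  · exact add_mem (Ideal.mul_mem_left _ _ hpl) (Ideal.mul_mem_left _ _ hrl)
  · exact add_mem (Ideal.mul_mem_left _ _ hpm) (Ideal.mul_mem_left _ _ hrm)
  · exact add_mem (Ideal.mul_mem_left _ _ hpl) (Ideal.mul_mem_left _ _ hrl)
  · exact add_mem (Ideal.mul_mem_left _ _ hlpm) (Ideal.mul_mem_left _ _ hlrm)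

theorem isOrdinaryNode_of_localPolynomial {Z : Set (Plane k)} {P : Plane k}
    {H : MvPolynomial (Fin 3) k} (hH : IsDefiningPolynomial H Z) (hP : P ∈ Z) {i : Fin 3}
    (hi : P.rep i ≠ 0) {a b c d : k} (hdet : a * d ≠ b * c)
    (h : localPolynomial H P.rep i - (C a * X 0 + C b * X 1) * (C c * X 0 + C d * X 1) ∈
      (Ideal.span {X 0, X 1} : Ideal (MvPolynomial (Fin 2) k)) ^ 3) : IsOrdinaryNode Z P := by
  refine ⟨hP, _, (isLocalEquation_iff hH _).mpr ⟨i, hi, 1, (one_mul _).symm⟩, a, b, c, d, hdet, ?_⟩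
  have hmap := Ideal.mem_map_of_mem (coeToMvPowerSeries.ringHom (R := k)) h
  rw [Ideal.map_pow, Ideal.map_span, Set.image_pair] at hmap
  simpa only [map_sub, map_mul, map_add, coeToMvPowerSeries.ringHom_apply, coe_X, coe_C] using hmap

theorem vec_ne_zero_of_last (x y : k) : (![x, y, 1] : Fin 3 → k) ≠ 0 := by
  intro h
  simpa using congrFun h 2

variable [IsAlgClosed k] {p n q d : ℕ} [Fact p.Prime] [CharP k p]

/-- The local equation is a quadratic form in the pullbacks of the partials of `h`. These are local
parameters at the point, and the form splits into distinct factors because `a ≠ b`. -/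
theorem isOrdinaryNode_mk (hn : 0 < n) (hq : q = p ^ n) (hd1 : (d : k) = 1) {a b x y : k}
    (ha : a = b ^ q) (hb : b = a ^ q) (hab : a ≠ b) (hx : x ^ d = (a + 1) * (b + 1))
    (hy : y ^ d = a * b) (hx0 : x ≠ 0) (hy0 : y ≠ 0) :
    IsOrdinaryNode (powerMap d ⁻¹' ballicoHefez k q)
      (Projectivization.mk k ![x, y, 1] (vec_ne_zero_of_last x y)) := by
  have hH := isDefiningPolynomial_expand (k := k) hn hq hd1
  set P := Projectivization.mk k ![x, y, 1] (vec_ne_zero_of_last x y) with hP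
  have hpow : (![x, y, 1] : Fin 3 → k) ^ d = ![(a + 1) * (b + 1), a * b, 1] := by
    ext i; fin_cases i <;> simp [hx, hy]
  have hPZ : P ∈ powerMap d ⁻¹' ballicoHefez k q := by
    rw [preimage_ballicoHefez_eq_locus hq, hP, mk_mem_locus_iff
      (expand_isHomogeneous (ballicoHefezPoly_isHomogeneous k q) d), eval_expand, hpow]
    have := eval_ballicoHefezPoly_quadric q a b (1 : k) 1
    rw [one_pow, mul_one, mul_one, mul_one, ← hb, sub_self, zero_mul] at this
    exact this
  obtain ⟨e, he⟩ := Projectivization.exists_smul_eq_mk_rep k _ (vec_ne_zero_of_last x y)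
  rw [← hP] at he
  have h2 : P.rep 2 = e := by rw [← he]; simp [Units.smul_def]
  have h0 : P.rep 0 / P.rep 2 = x := by
    rw [h2, ← he]; simp [Units.smul_def]
  have h1 : P.rep 1 / P.rep 2 = y := by
    rw [h2, ← he]; simp [Units.smul_def]
  have hchart : chartCoord P.rep 2 = ![X 0 + C x, X 1 + C y, 1] := by
    rw [← h0, ← h1]
    ext1 i
    fin_cases i
    · rfl
    · rfl
    · rfl
  set g : Fin 3 → MvPolynomial (Fin 2) k := ![(X 0 + C x) ^ d, (X 1 + C y) ^ d, 1] with hg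
  have hloc : localPolynomial (expand d (ballicoHefezPoly k q)) P.rep 2 =
      aeval g (ballicoHefezPoly k q) := by
    rw [localPolynomial_eq, aeval_expand, hchart, hg]
    congr 2
    ext1 i; fin_cases i <;> simp
  have hgc : (fun i => constantCoeff (g i)) = ![(a + 1) * (b + 1), a * b, 1] := by
    ext i; fin_cases i <;> simp [hg, hx, hy]
  have hcc : ∀ F : MvPolynomial (Fin 3) k, constantCoeff (aeval g F) =
      eval ![(a + 1) * (b + 1), a * b, 1] F := fun F => by rw [constantCoeff_aeval, hgc]
  have hd' : (d : MvPolynomial (Fin 2) k) = 1 := by rw [← map_natCast (C : k →+* _), hd1, map_one]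
  have hD0 : ∀ F : MvPolynomial (Fin 3) k, constantCoeff (pderiv 0 (aeval g F)) =
      eval ![(a + 1) * (b + 1), a * b, 1] (pderiv 0 F) * x ^ (d - 1) := by
    intro F
    rw [derivation_aeval, Fin.sum_univ_three]
    simp only [map_add, map_mul, hcc]
    simp [hg, Derivation.leibniz_pow, hd']
  have hD1 : ∀ F : MvPolynomial (Fin 3) k, constantCoeff (pderiv 1 (aeval g F)) =
      eval ![(a + 1) * (b + 1), a * b, 1] (pderiv 1 F) * y ^ (d - 1) := by
    intro F
    rw [derivation_aeval, Fin.sum_univ_three]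
    simp only [map_add, map_mul, hcc]
    simp [hg, Derivation.leibniz_pow, hd']
  obtain ⟨g0, g1⟩ := (gradient_quadric_eq_zero_iff hn hq a b).mpr ⟨ha, hb, hab⟩
  have hf : aeval g (ballicoHefezPoly k q) =
      (X 0 + C x) ^ d * aeval g (pderiv 0 (ballicoHefezPoly k q)) ^ 2 +
      ((X 0 + C x) ^ d + (X 1 + C y) ^ d - 1) * aeval g (pderiv 0 (ballicoHefezPoly k q)) *
        aeval g (pderiv 1 (ballicoHefezPoly k q)) +
      (X 1 + C y) ^ d * aeval g (pderiv 1 (ballicoHefezPoly k q)) ^ 2 := by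
    refine MvPolynomial.funext fun w => ?_
    have hw : ∀ F : MvPolynomial (Fin 3) k, eval w (aeval g F) =
        eval ![(w 0 + x) ^ d, (w 1 + y) ^ d, 1] F := by
      intro F
      rw [← aeval_eq_eval, ← aeval_eq_eval, ← AlgHom.comp_apply, comp_aeval]
      congr 2
      ext i; fin_cases i <;> simp [hg]
    simp only [map_add, map_sub, map_mul, map_pow, hw, eval_X, eval_C, map_one]
    exact eval_eq_quadratic_gradient hn hq _ _
  refine isOrdinaryNode_of_localPolynomial hH hPZ (by rw [h2]; exact e.ne_zero) ?_ (hloc ▸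
    quadratic_sub_mul_mem hf (a := a) (b := b) (by simp [hx]) (by simp [hy])
      ((hcc _).trans g0) ((hcc _).trans g1) (hD0 _) (hD1 _) (hD0 _) (hD1 _))
  intro h
  -- Up to sign, the determinant of the two tangent forms is the product of `x^(d-1) y^(d-1)` from
  -- the power map, the Hessian determinant of `h`, and `a - b`.
  have hess := hessian_quadric_ne_zero hn hq ha hb hab
  refine mul_ne_zero (mul_ne_zero (pow_ne_zero (d - 1) hx0) (pow_ne_zero (d - 1) hy0))
    (mul_ne_zero (sub_ne_zero.mpr hess) (sub_ne_zero.mpr hab)) ?_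
  linear_combination -h

end

/-! ### The singular points -/

section

variable {k : Type*} [Field k]

/-- At a point where `H = 0`, the product rule makes the gradient of `H G` a multiple of that of
`H`, so the Jacobian criterion can be tested on a generator. -/
theorem isSingularPoint_iff {Z : Set (Plane k)} {H : MvPolynomial (Fin 3) k}
    (hH : IsDefiningPolynomial H Z) (P : Plane k) :
    IsSingularPoint Z P ↔ P ∈ Z ∧ gradient H P.rep = 0 := by
  refine and_congr_right fun hP => ⟨fun h => h H ?_, fun h F hF => ?_⟩
  · rw [← hH.span_eq]; exact Ideal.mem_span_singleton_self H
  · rw [← hH.span_eq, Ideal.mem_span_singleton] at hF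
    obtain ⟨G, rfl⟩ := hF
    have h0 : eval P.rep H = 0 := by rw [← hH.locus_eq] at hP; exact hP
    funext i
    have hi : eval P.rep (pderiv i H) = 0 := congrFun h i
    simp [gradient, Derivation.leibniz, h0, hi]

theorem gradient_rep_mk_eq_zero_iff {F : MvPolynomial (Fin 3) k} {m : ℕ} (hF : F.IsHomogeneous m)
    (v : Fin 3 → k) (hv : v ≠ 0) :
    gradient F (Projectivization.mk k v hv).rep = 0 ↔ gradient F v = 0 := by
  simp only [funext_iff, gradient, Pi.zero_apply, eval_rep_mk_eq_zero_iff hF.pderiv v hv]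

theorem rep_mk_eq_zero_iff (v : Fin 3 → k) (hv : v ≠ 0) (i : Fin 3) :
    (Projectivization.mk k v hv).rep i = 0 ↔ v i = 0 := by
  simpa using eval_rep_mk_eq_zero_iff (isHomogeneous_X k i) v hv

variable {p n q d : ℕ} [Fact p.Prime] [CharP k p]

/-- The affine coordinates of the nodes. -/
def nodeCoords (k : Type*) [Field k] (q d : ℕ) : Set (k × k) :=
  {z | ∃ a b : k, (a = b ^ q ∧ b = a ^ q ∧ a ≠ b) ∧ z.1 ^ d = (a + 1) * (b + 1) ∧ z.2 ^ d = a * b}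

/-- A zero coordinate would make `a` or `b` equal to `-1` or `0`. These are fixed by Frobenius,
forcing `a = b`. -/
theorem ne_zero_of_mem_nodeCoords (hn : 0 < n) (hq : q = p ^ n) (hd : 0 < d) {z : k × k}
    (hz : z ∈ nodeCoords k q d) : z.1 ≠ 0 ∧ z.2 ≠ 0 := by
  have hq1 := one_lt_frobenius hn hq
  obtain ⟨a, b, ⟨ha, hb, hab⟩, hx, hy⟩ := hz
  constructor
  · intro h
    rw [h, zero_pow hd.ne', eq_comm, mul_eq_zero] at hx
    have key : ∀ a b : k, b = a ^ q → a + 1 = 0 → a = b := by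
      intro a b hb h
      rw [hb, eq_neg_of_add_eq_zero_left h, neg_pow_frobenius hq, one_pow]
    rcases hx with hx | hx
    · exact hab (key a b hb hx)
    · exact hab (key b a ha hx).symm
  · intro h
    rw [h, zero_pow hd.ne', eq_comm, mul_eq_zero] at hy
    rcases hy with rfl | rfl
    · exact hab (by rw [hb, zero_pow (by omega)])
    · exact hab (by rw [ha, zero_pow (by omega)])

/-- The nodes. -/
def nodes (k : Type*) [Field k] (q d : ℕ) : Set (Plane k) :=
  (fun z : k × k => Projectivization.mk k ![z.1, z.2, 1] (vec_ne_zero_of_last z.1 z.2)) ''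
    nodeCoords k q d

/-- The points on the coordinate axes. -/
def axisPoints (k : Type*) [Field k] (q d : ℕ) : Set (Plane k) :=
  {P | P ∈ powerMap d ⁻¹' ballicoHefez k q ∧ ∃ j, P.rep j = 0}

theorem disjoint_nodes_axisPoints (hn : 0 < n) (hq : q = p ^ n) (hd : 0 < d) :
    Disjoint (nodes k q d) (axisPoints k q d) := by
  rw [Set.disjoint_left]
  rintro P ⟨z, hz, rfl⟩ ⟨-, j, hj⟩
  obtain ⟨hx0, hy0⟩ := ne_zero_of_mem_nodeCoords hn hq hd hz
  rw [rep_mk_eq_zero_iff] at hj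
  fin_cases j
  · exact hx0 hj
  · exact hy0 hj
  · exact one_ne_zero hj

variable [IsAlgClosed k]

theorem eval_expand_axis (hn : 0 < n) (hq : q = p ^ n) (hd : 0 < d) {v : Fin 3 → k} {j : Fin 3}
    (hj : v j = 0) : eval v (expand d (ballicoHefezPoly k q)) =
      -(v (j + 1) ^ d - v (j + 2) ^ d) ^ (q + 1) := by
  obtain ⟨R, hR, -⟩ := exists_axis_form (k := k) hn hq j
  rw [eval_expand, hR]
  simp [hj, hd.ne']

/-- Along the axis, the partial in `x_j` carries the factor `x_j^(d-1)`. The other partials of the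
axis form are multiples of `(x_(j+1)^d - x_(j+2)^d)^q` or of `x_j^d`, and all of these vanish. -/
theorem gradient_expand_axis (hn : 0 < n) (hq : q = p ^ n) (hd1 : (d : k) = 1) (hd : 1 < d)
    {v : Fin 3 → k} (hv : eval v (expand d (ballicoHefezPoly k q)) = 0) {j : Fin 3}
    (hj : v j = 0) : gradient (expand d (ballicoHefezPoly k q)) v = 0 := by
  have hq1 := one_lt_frobenius hn hq
  obtain ⟨R, hR, -⟩ := exists_axis_form (k := k) hn hq j
  rw [eval_expand_axis hn hq (by omega) hj, neg_eq_zero] at hv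
  have hv' := eq_zero_of_pow_eq_zero hv
  funext i
  rw [gradient, pderiv_expand hd1, map_mul, eval_expand, map_pow, eval_X, Pi.zero_apply,
    mul_eq_zero]
  by_cases hij : i = j
  · left; rw [hij, hj, zero_pow (by omega)]
  · right
    rw [hR, map_add, map_neg, Derivation.leibniz_pow, Derivation.leibniz,
      pderiv_X_of_ne (Ne.symm hij), Nat.add_sub_cancel]
    simp [hv', hj, show d ≠ 0 by omega, show q ≠ 0 by omega]

/-- Off the axes the power map is étale, so singularity of the pullback is that of `h`. Vanishing of
two partials suffices: the quadratic form in the gradient gives `h = 0`, and Euler's relation gives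
the third partial. -/
theorem gradient_expand_chart (hn : 0 < n) (hq : q = p ^ n) (hd1 : (d : k) = 1) {x y a b : k}
    (hx : x ^ d = (a + 1) * (b + 1)) (hy : y ^ d = a * b) (hx0 : x ≠ 0) (hy0 : y ≠ 0) :
    (eval ![x, y, 1] (expand d (ballicoHefezPoly k q)) = 0 ∧
      gradient (expand d (ballicoHefezPoly k q)) ![x, y, 1] = 0) ↔
        a = b ^ q ∧ b = a ^ q ∧ a ≠ b := by
  have hq0 : (q : k) = 0 := natCast_frobenius_eq_zero hn hq
  have hpow : (![x, y, 1] : Fin 3 → k) ^ d = ![(a + 1) * (b + 1), a * b, 1] := by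
    ext i; fin_cases i <;> simp [hx, hy]
  have hg : ∀ i, gradient (expand d (ballicoHefezPoly k q)) ![x, y, 1] i = 0 ↔
      eval ![(a + 1) * (b + 1), a * b, 1] (pderiv i (ballicoHefezPoly k q)) = 0 := by
    intro i
    rw [gradient, pderiv_expand hd1, map_mul, eval_expand, map_pow, eval_X, hpow, mul_eq_zero,
      or_iff_right]
    refine pow_ne_zero _ ?_
    fin_cases i <;> simp [hx0, hy0]
  rw [← gradient_quadric_eq_zero_iff hn hq, eval_expand, hpow]
  constructor
  · rintro ⟨-, h⟩
    exact ⟨(hg 0).mp (congrFun h 0), (hg 1).mp (congrFun h 1)⟩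
  · rintro ⟨h0, h1⟩
    have hz : eval ![(a + 1) * (b + 1), a * b, 1] (ballicoHefezPoly k q) = 0 := by
      rw [eval_eq_quadratic_gradient hn hq, h0, h1]; ring
    refine ⟨hz, ?_⟩
    funext i
    rw [Pi.zero_apply, hg]
    have euler := congrArg (eval (![(a + 1) * (b + 1), a * b, 1] : Fin 3 → k))
      (ballicoHefezPoly_isHomogeneous k q).sum_X_mul_pderiv
    rw [Fin.sum_univ_three, map_nsmul, hz, smul_zero, map_add, map_add, map_mul, map_mul, map_mul,
      h0, h1, mul_zero, mul_zero, zero_add, zero_add, eval_X] at euler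
    replace euler := (one_mul _).symm.trans euler
    fin_cases i
    · exact h0
    · exact h1
    · exact euler

theorem setOf_isSingularPoint (hn : 0 < n) (hq : q = p ^ n) (hd1 : (d : k) = 1) (hd : 1 < d) :
    {P | IsSingularPoint (powerMap d ⁻¹' ballicoHefez k q) P} = nodes k q d ∪ axisPoints k q d := by
  have hH := isDefiningPolynomial_expand (k := k) hn hq hd1
  have hhom := expand_isHomogeneous (ballicoHefezPoly_isHomogeneous k q) d
  have hmem := preimage_ballicoHefez_eq_locus (k := k) hq d
  ext P
  rw [Set.mem_ofPred_eq, isSingularPoint_iff hH, Set.mem_union]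
  constructor
  · rintro ⟨hP, hg⟩
    by_cases hax : ∃ j, P.rep j = 0
    · exact Or.inr ⟨hP, hax⟩
    push Not at hax
    left
    have hmk : P = Projectivization.mk k ![P.rep 0 / P.rep 2, P.rep 1 / P.rep 2, 1]
        (vec_ne_zero_of_last _ _) := by
      conv_lhs => rw [← P.mk_rep]
      rw [Projectivization.mk_eq_mk_iff']
      refine ⟨P.rep 2, ?_⟩
      have := hax 2
      ext i; fin_cases i
      · simp; field_simp
      · simp; field_simp
      · simp
    have hx0 : P.rep 0 / P.rep 2 ≠ 0 := div_ne_zero (hax 0) (hax 2)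
    have hy0 : P.rep 1 / P.rep 2 ≠ 0 := div_ne_zero (hax 1) (hax 2)
    revert hx0 hy0 hmk
    generalize P.rep 0 / P.rep 2 = x
    generalize P.rep 1 / P.rep 2 = y
    rintro hmk hx0 hy0
    obtain ⟨a, b, hx, hy⟩ := exists_quadric_eq (x ^ d) (y ^ d) (1 : k) one_ne_zero
    rw [hmem, hmk, mk_mem_locus_iff hhom] at hP
    rw [hmk, gradient_rep_mk_eq_zero_iff hhom] at hg
    exact ⟨(x, y), ⟨a, b, (gradient_expand_chart hn hq hd1 hx hy hx0 hy0).mp ⟨hP, hg⟩, hx, hy⟩,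
      hmk.symm⟩
  · rintro (⟨z, hz, rfl⟩ | ⟨hP, j, hj⟩)
    · obtain ⟨hx0, hy0⟩ := ne_zero_of_mem_nodeCoords hn hq (by omega) hz
      obtain ⟨a, b, hab, hx, hy⟩ := hz
      rw [hmem, mk_mem_locus_iff hhom, gradient_rep_mk_eq_zero_iff hhom]
      exact (gradient_expand_chart hn hq hd1 hx hy hx0 hy0).mpr hab
    · refine ⟨hP, gradient_expand_axis hn hq hd1 hd ?_ hj⟩
      rw [hmem] at hP
      exact hP

/-! ### Counting -/

theorem encard_setOf_root {f : Polynomial k} (hf : f.Separable) :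
    {x | f.eval x = 0}.encard = f.natDegree := by
  classical
  have h : {x | f.eval x = 0} = (f.roots.toFinset : Set k) := by
    ext x
    simp [hf.ne_zero]
  rw [h, Set.encard_coe_eq_coe_finsetCard, Multiset.toFinset_card_of_nodup
    (Polynomial.nodup_roots hf), (IsAlgClosed.splits f).natDegree_eq_card_roots]

theorem encard_setOf_pow_eq (hd : (d : k) ≠ 0) {c : k} (hc : c ≠ 0) :
    {x : k | x ^ d = c}.encard = d := by
  have hd0 : 0 < d := Nat.pos_of_ne_zero (by rintro rfl; simp at hd)
  have := encard_setOf_root (Polynomial.separable_X_pow_sub_C c hd hc)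
  rw [Polynomial.natDegree_X_pow_sub_C] at this
  simpa [sub_eq_zero] using this

theorem encard_setOf_frobenius_eq (hn : 0 < n) (hq : q = p ^ n) :
    {x : k | x ^ q = x}.encard = q := by
  have hq1 := one_lt_frobenius hn hq
  have := encard_setOf_root (galois_poly_separable (K := k) p q (hq ▸ dvd_pow_self p hn.ne'))
  rw [FiniteField.X_pow_card_sub_X_natDegree_eq k hq1] at this
  simpa [sub_eq_zero] using this

theorem encard_setOf_frobenius_sq (hn : 0 < n) (hq : q = p ^ n) :
    {x : k | (x ^ q) ^ q = x ∧ x ^ q ≠ x}.encard = ((q ^ 2 - q : ℕ) : ℕ∞) := by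
  have h1 := encard_setOf_frobenius_eq (k := k) hn hq
  have h2 := encard_setOf_frobenius_eq (k := k) (n := n * 2) (q := q ^ 2) (by omega)
    (by rw [hq, pow_mul])
  have hdiff : {x : k | (x ^ q) ^ q = x ∧ x ^ q ≠ x} = {x | x ^ q ^ 2 = x} \ {x | x ^ q = x} := by
    ext x
    simp [← pow_mul, pow_two]
  rw [hdiff, Set.encard_sdiff, h1, h2]
  · rfl
  · intro x hx
    simp only [Set.mem_ofPred_eq] at hx ⊢
    rw [pow_two, pow_mul, hx, hx]
  · exact Set.finite_of_encard_eq_coe h1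

/-- The map `φ` is two-to-one on the `q² - q` elements of degree two over the field with `q`
elements, its fibres being the conjugate pairs `{a, a^q}`. Each value has nonzero coordinates, hence
`d` roots of order `d` in each. -/
theorem encard_nodeCoords (hn : 0 < n) (hq : q = p ^ n) (hd1 : (d : k) = 1) :
    (nodeCoords k q d).encard = ((d ^ 2 * ((q ^ 2 - q) / 2) : ℕ) : ℕ∞) := by
  classical
  have hd0 : 0 < d := Nat.pos_of_ne_zero (by rintro rfl; simp at hd1)
  have hA := encard_setOf_frobenius_sq (k := k) hn hq
  have hfin := Set.finite_of_encard_eq_coe hA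
  set A := hfin.toFinset with hAdef
  have hAcard : A.card = q ^ 2 - q := by
    rw [hfin.encard_eq_coe_toFinset_card] at hA
    exact_mod_cast hA
  have hAmem : ∀ x, x ∈ A ↔ (x ^ q) ^ q = x ∧ x ^ q ≠ x := fun x => by simp [hAdef]
  set φ : k → k × k := fun a => ((a + 1) * (a ^ q + 1), a * a ^ q) with hφ
  set V := A.image φ with hV
  have hcard : A.card = V.card * 2 := by
    rw [Finset.card_eq_sum_card_image φ A, ← smul_eq_mul, ← Finset.sum_const]
    refine Finset.sum_congr rfl fun v hv => ?_
    obtain ⟨a, ha, rfl⟩ := Finset.mem_image.mp hv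
    obtain ⟨ha1, ha2⟩ := (hAmem a).mp ha
    have : A.filter (fun x => φ x = φ a) = {a, a ^ q} := by
      ext x
      rw [Finset.mem_filter, Finset.mem_insert, Finset.mem_singleton, hAmem]
      constructor
      · rintro ⟨-, h⟩
        obtain ⟨e1, e2⟩ := Prod.mk.inj h
        -- Equal values of `φ` mean equal trace and norm, so `x` is a root of the quadratic
        -- polynomial with roots `a` and `a^q`.
        have : (x - a) * (x - a ^ q) = 0 := by linear_combination x * e1 - (x + 1) * e2
        rcases mul_eq_zero.mp this with h | h
        · exact Or.inl (sub_eq_zero.mp h)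
        · exact Or.inr (sub_eq_zero.mp h)
      · rintro (rfl | rfl)
        · exact ⟨⟨ha1, ha2⟩, rfl⟩
        · refine ⟨⟨by rw [ha1], fun h => ha2 ?_⟩, ?_⟩
          · rw [ha1] at h; exact h.symm
          · simp only [hφ, ha1]
            rw [mul_comm (a ^ q + 1), mul_comm (a ^ q)]
    rw [this, Finset.card_pair ha2.symm]
  have hVcard : V.card = (q ^ 2 - q) / 2 := by omega
  have hroots : ∀ c : k, {x : k | x ^ d = c}.Finite := by
    intro c
    by_cases hc : c = 0
    · refine (Set.finite_singleton (0 : k)).subset fun x hx => ?_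
      rw [Set.mem_ofPred_eq, hc] at hx
      exact eq_zero_of_pow_eq_zero hx
    · exact Set.finite_of_encard_eq_coe (encard_setOf_pow_eq (by rw [hd1]; exact one_ne_zero) hc)
  have hrcard : ∀ c : k, c ≠ 0 → (hroots c).toFinset.card = d := by
    intro c hc
    have := encard_setOf_pow_eq (d := d) (by rw [hd1]; exact one_ne_zero) hc
    rw [(hroots c).encard_eq_coe_toFinset_card] at this
    exact_mod_cast this
  set S := V.biUnion fun v => (hroots v.1).toFinset ×ˢ (hroots v.2).toFinset with hS
  have hSmem : ∀ z : k × k, z ∈ S ↔ (z.1 ^ d, z.2 ^ d) ∈ V := by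
    intro z
    simp only [hS, Finset.mem_biUnion, Finset.mem_product, Set.Finite.mem_toFinset,
      Set.mem_ofPred_eq]
    constructor
    · rintro ⟨v, hv, h1, h2⟩
      rw [h1, h2]; exact hv
    · intro h
      exact ⟨_, h, rfl, rfl⟩
  have hSeq : nodeCoords k q d = S := by
    ext z
    rw [Finset.mem_coe, hSmem, hV, Finset.mem_image]
    constructor
    · rintro ⟨a, b, ⟨ha, rfl, hab⟩, hx, hy⟩
      exact ⟨a, (hAmem a).mpr ⟨ha.symm, hab.symm⟩, by rw [hx, hy]⟩
    · rintro ⟨a, ha, h⟩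
      obtain ⟨ha1, ha2⟩ := (hAmem a).mp ha
      obtain ⟨e1, e2⟩ := Prod.mk.inj h
      exact ⟨a, a ^ q, ⟨ha1.symm, rfl, ha2.symm⟩, e1.symm, e2.symm⟩
  have hSne : ∀ v ∈ V, v.1 ≠ 0 ∧ v.2 ≠ 0 := by
    intro v hv
    obtain ⟨x, hx⟩ := IsAlgClosed.exists_pow_nat_eq v.1 hd0
    obtain ⟨y, hy⟩ := IsAlgClosed.exists_pow_nat_eq v.2 hd0
    have hz : (x, y) ∈ nodeCoords k q d := by
      rw [hSeq, Finset.mem_coe, hSmem]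
      simpa only [hx, hy] using hv
    obtain ⟨h1, h2⟩ := ne_zero_of_mem_nodeCoords hn hq hd0 hz
    rw [← hx, ← hy]
    exact ⟨pow_ne_zero _ h1, pow_ne_zero _ h2⟩
  rw [hSeq, Set.encard_coe_eq_coe_finsetCard, hS, Finset.card_biUnion]
  · rw [Finset.sum_congr rfl (g := fun _ => d * d), Finset.sum_const, hVcard, smul_eq_mul]
    · congr 1; ring
    · intro v hv
      obtain ⟨h1, h2⟩ := hSne v hv
      rw [Finset.card_product, hrcard _ h1, hrcard _ h2]
  · intro v _ w _ hvw
    refine Finset.disjoint_left.mpr ?_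
    rintro z hz hz'
    simp only [Finset.mem_product, Set.Finite.mem_toFinset, Set.mem_ofPred_eq] at hz hz'
    exact hvw (Prod.ext (hz.1.symm.trans hz'.1) (hz.2.symm.trans hz'.2))

theorem encard_nodes (hn : 0 < n) (hq : q = p ^ n) (hd1 : (d : k) = 1) :
    (nodes k q d).encard = ((d ^ 2 * ((q ^ 2 - q) / 2) : ℕ) : ℕ∞) := by
  rw [nodes, Function.Injective.encard_image, encard_nodeCoords hn hq hd1]
  intro z w h
  obtain ⟨a, ha⟩ := (Projectivization.mk_eq_mk_iff' k _ _ _ _).mp h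
  have h2 : a = 1 := by simpa using congrFun ha 2
  rw [h2, one_smul] at ha
  exact Prod.ext (congrFun ha 0).symm (congrFun ha 1).symm

/-- The representatives of the points on the coordinate axes. -/
def axisVector {k : Type*} [Field k] (j : Fin 3) (c : k) : Fin 3 → k :=
  fun i => if i = j then 0 else if i = j + 1 then 1 else c

theorem axisVector_ne_zero {k : Type*} [Field k] (j : Fin 3) (c : k) : axisVector j c ≠ 0 := by
  intro h
  have := congrFun h (j + 1)
  simp [axisVector] at this

theorem axisVector_self {k : Type*} [Field k] (j : Fin 3) (c : k) : axisVector j c j = 0 := by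
  simp [axisVector]

theorem axisVector_add_one {k : Type*} [Field k] (j : Fin 3) (c : k) :
    axisVector j c (j + 1) = 1 := by
  simp [axisVector]

theorem axisVector_add_two {k : Type*} [Field k] (j : Fin 3) (c : k) :
    axisVector j c (j + 2) = c := by
  simp [axisVector]

theorem eq_or_eq_add_one_or_eq_add_two (i j : Fin 3) : i = j ∨ i = j + 1 ∨ i = j + 2 := by
  revert i j; decide

theorem axisPoints_eq_image (hn : 0 < n) (hq : q = p ^ n) (hd : 0 < d) :
    axisPoints k q d = (fun z : Fin 3 × k => Projectivization.mk k (axisVector z.1 z.2)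
      (axisVector_ne_zero z.1 z.2)) '' (Set.univ ×ˢ {c : k | c ^ d = 1}) := by
  have hhom := expand_isHomogeneous (ballicoHefezPoly_isHomogeneous k q) d
  ext P
  constructor
  · rintro ⟨hP, j, hj⟩
    rw [preimage_ballicoHefez_eq_locus hq] at hP
    have hP' : eval P.rep (expand d (ballicoHefezPoly k q)) = 0 := hP
    rw [eval_expand_axis hn hq hd hj, neg_eq_zero] at hP'
    replace hP' := sub_eq_zero.mp (eq_zero_of_pow_eq_zero hP')
    have h1 : P.rep (j + 1) ≠ 0 := by
      intro h1
      rw [h1, zero_pow hd.ne', eq_comm] at hP'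
      have h2 := eq_zero_of_pow_eq_zero hP'
      refine P.rep_nonzero (funext fun i => ?_)
      rcases eq_or_eq_add_one_or_eq_add_two i j with rfl | rfl | rfl
      · exact hj
      · exact h1
      · exact h2
    refine ⟨(j, P.rep (j + 2) / P.rep (j + 1)), ⟨Set.mem_univ _, ?_⟩, ?_⟩
    · rw [Set.mem_ofPred_eq, div_pow, hP', div_self]
      rw [← hP']
      exact pow_ne_zero _ h1
    · conv_rhs => rw [← P.mk_rep]
      rw [Projectivization.mk_eq_mk_iff']
      refine ⟨(P.rep (j + 1))⁻¹, funext fun i => ?_⟩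
      rw [Pi.smul_apply, smul_eq_mul]
      rcases eq_or_eq_add_one_or_eq_add_two i j with rfl | rfl | rfl
      · rw [hj, axisVector_self, mul_zero]
      · rw [axisVector_add_one, inv_mul_cancel₀ h1]
      · rw [axisVector_add_two, inv_mul_eq_div]
  · rintro ⟨⟨j, c⟩, ⟨-, hc⟩, rfl⟩
    refine ⟨?_, j, (rep_mk_eq_zero_iff _ _ _).mpr (axisVector_self j c)⟩
    rw [preimage_ballicoHefez_eq_locus hq, mk_mem_locus_iff hhom,
      eval_expand_axis hn hq hd (axisVector_self j c), axisVector_add_one, axisVector_add_two,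
      one_pow, show c ^ d = 1 from hc]
    simp

theorem encard_axisPoints (hn : 0 < n) (hq : q = p ^ n) (hd1 : (d : k) = 1) :
    (axisPoints k q d).encard = ((3 * d : ℕ) : ℕ∞) := by
  have hd0 : 0 < d := Nat.pos_of_ne_zero (by rintro rfl; simp at hd1)
  rw [axisPoints_eq_image hn hq hd0, Set.InjOn.encard_image]
  · have := encard_setOf_pow_eq (k := k) (d := d) (by rw [hd1]; exact one_ne_zero) one_ne_zero
    rw [Set.encard_prod, this, Set.encard_univ]
    simp
  · rintro ⟨j, c⟩ ⟨-, hc⟩ ⟨j', c'⟩ ⟨-, hc'⟩ h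
    -- Consequently exactly one coordinate of the point vanishes, so the point determines its axis.
    have hc0 : c' ≠ 0 := by
      rintro rfl
      rw [Set.mem_ofPred_eq, zero_pow hd0.ne'] at hc'
      exact zero_ne_one hc'
    obtain ⟨a, ha⟩ := (Projectivization.mk_eq_mk_iff' k _ _ _ _).mp h
    have ha' : ∀ i, a * axisVector j' c' i = axisVector j c i := fun i => congrFun ha i
    have ha0 : a ≠ 0 := by
      rintro rfl
      refine axisVector_ne_zero j c (funext fun i => ?_)
      rw [← ha' i, zero_mul]; rfl
    obtain rfl : j = j' := by
      have hj := ha' j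
      rw [axisVector_self, mul_eq_zero, or_iff_right ha0] at hj
      rcases eq_or_eq_add_one_or_eq_add_two j j' with h | h | h
      · exact h
      · rw [h, axisVector_add_one] at hj
        exact absurd hj one_ne_zero
      · rw [h, axisVector_add_two] at hj
        exact absurd hj hc0
    have h1 := ha' (j + 1)
    rw [axisVector_add_one, axisVector_add_one, mul_one] at h1
    have h2 := ha' (j + 2)
    rw [axisVector_add_two, axisVector_add_two, h1, one_mul] at h2
    rw [h2]

end

end PlaneCurve

end

theorem theorem2 {k : Type*} [Field k] [IsAlgClosed k] (p : ℕ) [Fact p.Prime] [CharP k p]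
    (n : ℕ) (hn : 0 < n) (q d : ℕ) (hq : q = p ^ n) (hd : d = q ^ 2 + q + 1) :
    -- (i) the dual curve is the preimage of the Ballico–Hefez curve, as a set and as a scheme
    (PlaneCurve.dualCurve (PlaneCurve.fermat k d) =
        PlaneCurve.powerMap d ⁻¹' PlaneCurve.ballicoHefez k q ∧
      ∃ h : MvPolynomial (Fin 3) k,
        PlaneCurve.IsDefiningPolynomial h (PlaneCurve.ballicoHefez k q) ∧
        PlaneCurve.IsDefiningPolynomial (MvPolynomial.expand d h)
          (PlaneCurve.dualCurve (PlaneCurve.fermat k d))) ∧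
    -- (ii) the singularities of the dual curve
    ∃ N M : Set (PlaneCurve.Plane k),
      {P | PlaneCurve.IsSingularPoint (PlaneCurve.dualCurve (PlaneCurve.fermat k d)) P} = N ∪ M ∧
      Disjoint N M ∧
      N.encard = ((d ^ 2 * ((q ^ 2 - q) / 2) : ℕ) : ℕ∞) ∧
      (∀ P ∈ N, PlaneCurve.IsOrdinaryNode (PlaneCurve.dualCurve (PlaneCurve.fermat k d)) P) ∧
      M.encard = ((3 * d : ℕ) : ℕ∞) ∧
      (∀ P ∈ M, PlaneCurve.HasMilnorNumber (PlaneCurve.dualCurve (PlaneCurve.fermat k d)) P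
        ((q ^ 2 * (q + 1) : ℕ) : ℕ∞)) := by
  have hd1 : (d : k) = 1 := by
    rw [hd]; push_cast; rw [PlaneCurve.natCast_frobenius_eq_zero hn hq]; ring
  have hdlt : 1 < d := by
    have := PlaneCurve.one_lt_frobenius hn hq
    omega
  rw [PlaneCurve.dualCurve_fermat hn hq hd hd1]
  refine ⟨⟨rfl, _, PlaneCurve.isDefiningPolynomial_ballicoHefezPoly hn hq,
    PlaneCurve.isDefiningPolynomial_expand hn hq hd1⟩,
    PlaneCurve.nodes k q d, PlaneCurve.axisPoints k q d,
    PlaneCurve.setOf_isSingularPoint hn hq hd1 hdlt,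
    PlaneCurve.disjoint_nodes_axisPoints hn hq (by omega), PlaneCurve.encard_nodes hn hq hd1, ?_,
    PlaneCurve.encard_axisPoints hn hq hd1, ?_⟩
  · rintro P ⟨z, hz, rfl⟩
    obtain ⟨hx0, hy0⟩ := PlaneCurve.ne_zero_of_mem_nodeCoords hn hq (by omega) hz
    obtain ⟨a, b, ⟨ha, hb, hab⟩, hx, hy⟩ := hz
    exact PlaneCurve.isOrdinaryNode_mk hn hq hd1 ha hb hab hx hy hx0 hy0
  · rintro P ⟨hP, j, hj⟩
    exact PlaneCurve.hasMilnorNumber_axis hn hq hd hP hj
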